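/- Setting. Fix a countably infinite set of propositional variables. Superintuitionistic modal ($\sim$-) formulae are built from variables by $\bot,\top,\land,\lor,\to,\boxtimes$; classical modal ($\mathit{clm}$-) formulae are built by $\bot,\top,\land,\neg,\square$, with $\lor,\to$ defined as usual and $\square^+\varphi:=\square\varphi\land\varphi$. A rule $\Gamma/\Delta$ is a pair of finite sets of formulae, and $/\varphi$ denotes $\varnothing/\{\varphi\}$. A rule system is a set of rules that is closed under substitution, weakening ($\Gamma/\Delta\mapsto\Gamma\cup\Gamma'/\Delta\cup\Delta'$ with $\Gamma',\Delta'$ finite) and cut, and contains $\varphi/\varphi$, modus ponens $\varphi,\varphi\to\psi/\psi$ and necessitation $\varphi/\boxtimes\varphi$ (resp. $\varphi/\square\varphi$), for all formulae $\varphi,\psi$. For sets of rules, $\oplus$ denotes the least rule system containing both. $\mathsf{mHC}$ is the least $\sim$-rule system containing $/\varphi$ for all theorems $\varphi$ of intuitionistic propositional logic and $/\boxtimes(p\to q)\to(\boxtimes p\to\boxtimes q)$, $/p\to\boxtimes p$, $/\boxtimes p\to(q\lor(q\to p))$; $\mathsf{KM}$ is the least rule system containing $\mathsf{mHC}$ and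 $/(\boxtimes p\to p)\to p$. $\mathsf{K4}$ is the least $\mathit{clm}$-rule system containing $/\varphi$ for all $\varphi$ valid in all transitive Kripke frames, and $\mathsf{K4.Grz}$ is $\mathsf{K4}\oplus\{/\square(\square(p\to\square p)\to p)\to\square p\}$. The translation $T$ is given by $T(p)=\square^+p$, $T(\bot)=\bot$, $T(\top)=\top$, $T(\varphi\land\psi)=T\varphi\land T\psi$, $T(\varphi\lor\psi)=T\varphi\lor T\psi$, $T(\varphi\to\psi)=\square^+(\neg T\varphi\lor T\psi)$, $T(\boxtimes\varphi)=\square T\varphi$ and $T(\Gamma/\Delta)=T[\Gamma]/T[\Delta]$. For a $\sim$-rule system $L$ put $\tau L:=\mathsf{K4}\oplus\{T(\Gamma/\Delta):\Gamma/\Delta\in L\}$ and $\sigma L:=\mathsf{K4.Grz}\oplus\tau L$. A $\sim$-Kripke frame is a (possibly empty) set $X$ with relations $\le,\sqsubset$ such that $\le$ is reflexive, transitive and equal to the reflexive closure of $\sqsubset$; variables are interpreted by $\le$-upsets, $\bot,\top,\land,\lor$ as usual, $V(\varphi\to\psi)=\{x:\forall y\ge x\,(y\in V(\varphi)\Rightarrow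 y\in V(\psi))\}$ and $V(\boxtimes\varphi)=\{x:\forall y\,(x\sqsubset y\Rightarrow y\in V(\varphi))\}$. A $\mathit{clm}$-Kripke frame is a (possibly empty) set with a binary relation $R$, with the usual modal semantics. A rule $\Gamma/\Delta$ is valid in a frame if, for every interpretation $V$ such that $V(\gamma)=X$ for all $\gamma\in\Gamma$, there is $\delta\in\Delta$ with $V(\delta)=X$; otherwise it is refuted. A frame is a frame for $S$ if it validates all rules in $S$. A rule system $S$ is Kripke complete if each rule not in $S$ is refuted in some Kripke frame for $S$, and has the finite model property if each rule not in $S$ is refuted in some finite Kripke frame for $S$. Theorem. Let $L$ be a $\sim$-rule system extending $\mathsf{KM}$ (for instance, a logic, i.e. a rule system axiomatized by rules of the form $/\varphi$). Then $\tau L=\sigma L$, and: 1. $L$ is Kripke complete if and only if $\tau L$ is Kripke complete. 2. $L$ has the finite model property if and only if $\tau L$ has the finite model property. -/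

import Mathlib

universe u

namespace ModalCompanion

/-- Superintuitionistic modal formulae, over the countable set `ℕ` of propositional variables. -/
inductive SimForm : Type
  | var : ℕ → SimForm
  | bot : SimForm
  | top : SimForm
  | and : SimForm → SimForm → SimForm
  | or : SimForm → SimForm → SimForm
  | imp : SimForm → SimForm → SimForm
  | box : SimForm → SimForm
  deriving DecidableEq

/-- Classical modal formulae, with primitive connectives `⊥, ⊤, ∧, ¬, □`. -/
inductive ClmForm : Type
  | var : ℕ → ClmForm
  | bot : ClmForm
  | top : ClmForm
  | and : ClmForm → ClmForm → ClmForm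
  | neg : ClmForm → ClmForm
  | box : ClmForm → ClmForm
  deriving DecidableEq

/-- `φ ∨ ψ := ¬(¬φ ∧ ¬ψ)`. -/
def ClmForm.or (φ ψ : ClmForm) : ClmForm := .neg (.and (.neg φ) (.neg ψ))

/-- `φ → ψ := ¬φ ∨ ψ`. -/
def ClmForm.imp (φ ψ : ClmForm) : ClmForm := .or (.neg φ) ψ

/-- `□⁺φ := □φ ∧ φ`. -/
def ClmForm.boxPlus (φ : ClmForm) : ClmForm := .and (.box φ) φ

/-- The substitution (homomorphism of formulae) determined by its values on variables. -/
def SimForm.subst (s : ℕ → SimForm) : SimForm → SimForm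
  | .var n => s n
  | .bot => .bot
  | .top => .top
  | .and φ ψ => .and (φ.subst s) (ψ.subst s)
  | .or φ ψ => .or (φ.subst s) (ψ.subst s)
  | .imp φ ψ => .imp (φ.subst s) (ψ.subst s)
  | .box φ => .box (φ.subst s)

/-- The substitution (homomorphism of formulae) determined by its values on variables. -/
def ClmForm.subst (s : ℕ → ClmForm) : ClmForm → ClmForm
  | .var n => s n
  | .bot => .bot
  | .top => .top
  | .and φ ψ => .and (φ.subst s) (ψ.subst s)
  | .neg φ => .neg (φ.subst s)
  | .box φ => .box (φ.subst s)

/-! ### Rules and rule systems -/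

/-- A rule `Γ/Δ` is a pair of finite sets of formulae. -/
abbrev Rule (F : Type) : Type := Finset F × Finset F

/-- The assumption-free single-conclusion rule `/φ`. -/
def ax {F : Type} (φ : F) : Rule F := (∅, {φ})

/-- The image of a rule under a map of formulae: `f(Γ/Δ) = f[Γ]/f[Δ]`. -/
def Rule.map {F G : Type} [DecidableEq G] (f : F → G) (r : Rule F) : Rule G :=
  (r.1.image f, r.2.image f)

/-- Rule systems in a signature with formulae `F`, implication `imp`, modality `box` and
substitutions `subst s`. -/
structure IsRuleSystem {F : Type} [DecidableEq F] (imp : F → F → F) (box : F → F)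
    (subst : (ℕ → F) → F → F) (S : Set (Rule F)) : Prop where
  structurality : ∀ (s : ℕ → F) (r : Rule F), r ∈ S → r.map (subst s) ∈ S
  reflexivity : ∀ φ : F, (({φ}, {φ}) : Rule F) ∈ S
  monotonicity : ∀ Γ Δ Γ' Δ' : Finset F,
    ((Γ, Δ) : Rule F) ∈ S → ((Γ ∪ Γ', Δ ∪ Δ') : Rule F) ∈ S
  cut : ∀ (Γ Δ : Finset F) (φ : F),
    ((Γ, insert φ Δ) : Rule F) ∈ S → ((insert φ Γ, Δ) : Rule F) ∈ S → ((Γ, Δ) : Rule F) ∈ S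
  modusPonens : ∀ φ ψ : F, (({φ, imp φ ψ}, {ψ}) : Rule F) ∈ S
  necessitation : ∀ φ : F, (({φ}, {box φ}) : Rule F) ∈ S

abbrev SimRule : Type := Rule SimForm

abbrev ClmRule : Type := Rule ClmForm

def IsSimRuleSystem (S : Set SimRule) : Prop :=
  IsRuleSystem SimForm.imp SimForm.box SimForm.subst S

def IsClmRuleSystem (S : Set ClmRule) : Prop :=
  IsRuleSystem ClmForm.imp ClmForm.box ClmForm.subst S

/-- The least rule system containing a given set of rules. -/
def simGen (Ξ : Set SimRule) : Set SimRule := ⋂₀ {S | IsSimRuleSystem S ∧ Ξ ⊆ S}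

/-- The least rule system containing a given set of rules. -/
def clmGen (Ξ : Set ClmRule) : Set ClmRule := ⋂₀ {S | IsClmRuleSystem S ∧ Ξ ⊆ S}

theorem isRuleSystem_sInter {F : Type} [DecidableEq F] {imp : F → F → F} {box : F → F}
    {subst : (ℕ → F) → F → F} {C : Set (Set (Rule F))}
    (h : ∀ S ∈ C, IsRuleSystem imp box subst S) : IsRuleSystem imp box subst (⋂₀ C) where
  structurality s r hr S hS := (h S hS).structurality s r (hr S hS)
  reflexivity φ S hS := (h S hS).reflexivity φ
  monotonicity Γ Δ Γ' Δ' hr S hS := (h S hS).monotonicity Γ Δ Γ' Δ' (hr S hS)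
  cut Γ Δ φ h₁ h₂ S hS := (h S hS).cut Γ Δ φ (h₁ S hS) (h₂ S hS)
  modusPonens φ ψ S hS := (h S hS).modusPonens φ ψ
  necessitation φ S hS := (h S hS).necessitation φ

theorem isSimRuleSystem_simGen (Ξ : Set SimRule) : IsSimRuleSystem (simGen Ξ) :=
  isRuleSystem_sInter fun _ hS => hS.1

theorem isClmRuleSystem_clmGen (Ξ : Set ClmRule) : IsClmRuleSystem (clmGen Ξ) :=
  isRuleSystem_sInter fun _ hS => hS.1

theorem subset_simGen (Ξ : Set SimRule) : Ξ ⊆ simGen Ξ := fun _ hr _ hS => hS.2 hr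

theorem subset_clmGen (Ξ : Set ClmRule) : Ξ ⊆ clmGen Ξ := fun _ hr _ hS => hS.2 hr

/-! ### Kripke semantics -/

/-- A `∼`-Kripke frame `(X, ≤, ⊏)`: `≤` is reflexive and transitive, and is the reflexive closure
of `⊏`. (It follows that `{x | ↑⊏ x ⊆ U}` is an upset whenever `U` is one, see
`SimFrame.isUp_boxSet`.) -/
structure SimFrame where
  carrier : Type u
  le : carrier → carrier → Prop
  rel : carrier → carrier → Prop
  le_refl : ∀ x, le x x
  le_trans : ∀ x y z, le x y → le y z → le x z
  le_iff : ∀ x y, le x y ↔ x = y ∨ rel x y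

/-- A `clm`-Kripke frame `(X, R)`. -/
structure ClmFrame where
  carrier : Type u
  rel : carrier → carrier → Prop

/-- Upsets with respect to `≤`. -/
def SimFrame.IsUp (X : SimFrame.{u}) (U : Set X.carrier) : Prop :=
  ∀ x y, X.le x y → x ∈ U → y ∈ U

/-- `{x | ↑⊏ x ⊆ U}`. -/
def SimFrame.boxSet (X : SimFrame.{u}) (U : Set X.carrier) : Set X.carrier :=
  {x | ∀ y, X.rel x y → y ∈ U}

theorem SimFrame.isUp_boxSet (X : SimFrame.{u}) {U : Set X.carrier} (hU : X.IsUp U) :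
    X.IsUp (X.boxSet U) := by
  intro x y hxy hx z hyz
  rcases (X.le_iff x y).1 hxy with rfl | h
  · exact hx z hyz
  · exact hU y z ((X.le_iff y z).2 (Or.inr hyz)) (hx y h)

/-- The interpretation of formulae determined by the values `V` of the variables. -/
def SimFrame.interp (X : SimFrame.{u}) (V : ℕ → Set X.carrier) : SimForm → Set X.carrier
  | .var n => V n
  | .bot => ∅
  | .top => Set.univ
  | .and φ ψ => X.interp V φ ∩ X.interp V ψ
  | .or φ ψ => X.interp V φ ∪ X.interp V ψ
  | .imp φ ψ => {x | ∀ y, X.le x y → y ∈ X.interp V φ → y ∈ X.interp V ψ}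
  | .box φ => X.boxSet (X.interp V φ)

theorem SimFrame.isUp_interp (X : SimFrame.{u}) {V : ℕ → Set X.carrier}
    (hV : ∀ n, X.IsUp (V n)) (φ : SimForm) : X.IsUp (X.interp V φ) := by
  induction φ with
  | var n => exact hV n
  | bot => exact fun _ _ _ h => h
  | top => exact fun _ _ _ h => h
  | and φ ψ ih₁ ih₂ => exact fun x y h hx => ⟨ih₁ x y h hx.1, ih₂ x y h hx.2⟩
  | or φ ψ ih₁ ih₂ => exact fun x y h hx => hx.imp (ih₁ x y h) (ih₂ x y h)
  | imp φ ψ _ _ => exact fun x y h hx z hz => hx z (X.le_trans x y z h hz)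
  | box φ ih => exact X.isUp_boxSet ih

/-- The interpretation of formulae determined by the values `V` of the variables. -/
def ClmFrame.interp (X : ClmFrame.{u}) (V : ℕ → Set X.carrier) : ClmForm → Set X.carrier
  | .var n => V n
  | .bot => ∅
  | .top => Set.univ
  | .and φ ψ => X.interp V φ ∩ X.interp V ψ
  | .neg φ => (X.interp V φ)ᶜ
  | .box φ => {x | ∀ y, X.rel x y → y ∈ X.interp V φ}

/-- Validity of a rule in a `∼`-Kripke frame; variables take upsets as values. -/
def SimFrame.Valid (X : SimFrame.{u}) (r : SimRule) : Prop :=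
  ∀ V : ℕ → Set X.carrier, (∀ n, X.IsUp (V n)) →
    (∀ γ ∈ r.1, X.interp V γ = Set.univ) → ∃ δ ∈ r.2, X.interp V δ = Set.univ

/-- Validity of a rule in a `clm`-Kripke frame. -/
def ClmFrame.Valid (X : ClmFrame.{u}) (r : ClmRule) : Prop :=
  ∀ V : ℕ → Set X.carrier,
    (∀ γ ∈ r.1, X.interp V γ = Set.univ) → ∃ δ ∈ r.2, X.interp V δ = Set.univ

/-- `X` is a Kripke frame for `S`. -/
def SimFrame.IsFrameFor (X : SimFrame.{u}) (S : Set SimRule) : Prop := ∀ r ∈ S, X.Valid r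

/-- `X` is a Kripke frame for `S`. -/
def ClmFrame.IsFrameFor (X : ClmFrame.{u}) (S : Set ClmRule) : Prop := ∀ r ∈ S, X.Valid r

/-- Kripke completeness: every rule outside `S` is refuted in some Kripke frame for `S`. -/
def SimKripkeComplete (S : Set SimRule) : Prop :=
  ∀ r : SimRule, r ∉ S → ∃ X : SimFrame.{u}, X.IsFrameFor S ∧ ¬ X.Valid r

/-- Kripke completeness: every rule outside `S` is refuted in some Kripke frame for `S`. -/
def ClmKripkeComplete (S : Set ClmRule) : Prop :=
  ∀ r : ClmRule, r ∉ S → ∃ X : ClmFrame.{u}, X.IsFrameFor S ∧ ¬ X.Valid r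

/-- Finite model property: every rule outside `S` is refuted in some finite Kripke frame
for `S`. -/
def SimFMP (S : Set SimRule) : Prop :=
  ∀ r : SimRule, r ∉ S →
    ∃ X : SimFrame.{u}, Finite X.carrier ∧ X.IsFrameFor S ∧ ¬ X.Valid r

/-- Finite model property: every rule outside `S` is refuted in some finite Kripke frame
for `S`. -/
def ClmFMP (S : Set ClmRule) : Prop :=
  ∀ r : ClmRule, r ∉ S →
    ∃ X : ClmFrame.{u}, Finite X.carrier ∧ X.IsFrameFor S ∧ ¬ X.Valid r

/-! ### The systems `mHC` and `KM` -/

/-- Theorems of the intuitionistic propositional calculus and their substitution instances, by a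
Hilbert calculus. -/
inductive IPC : SimForm → Prop
  | k (φ ψ : SimForm) : IPC (.imp φ (.imp ψ φ))
  | s (φ ψ χ : SimForm) :
      IPC (.imp (.imp φ (.imp ψ χ)) (.imp (.imp φ ψ) (.imp φ χ)))
  | andLeft (φ ψ : SimForm) : IPC (.imp (.and φ ψ) φ)
  | andRight (φ ψ : SimForm) : IPC (.imp (.and φ ψ) ψ)
  | andIntro (φ ψ : SimForm) : IPC (.imp φ (.imp ψ (.and φ ψ)))
  | orLeft (φ ψ : SimForm) : IPC (.imp φ (.or φ ψ))
  | orRight (φ ψ : SimForm) : IPC (.imp ψ (.or φ ψ))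
  | orElim (φ ψ χ : SimForm) :
      IPC (.imp (.imp φ χ) (.imp (.imp ψ χ) (.imp (.or φ ψ) χ)))
  | botElim (φ : SimForm) : IPC (.imp .bot φ)
  | topIntro : IPC .top
  | mp {φ ψ : SimForm} : IPC (.imp φ ψ) → IPC φ → IPC ψ

/-- `⊠(p → q) → (⊠p → ⊠q)`. -/
def axK : SimForm :=
  .imp (.box (.imp (.var 0) (.var 1))) (.imp (.box (.var 0)) (.box (.var 1)))

/-- `p → ⊠p`. -/
def axR : SimForm := .imp (.var 0) (.box (.var 0))

/-- `⊠p → (q ∨ (q → p))`. -/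
def axD : SimForm := .imp (.box (.var 0)) (.or (.var 1) (.imp (.var 1) (.var 0)))

/-- `(⊠p → p) → p`. -/
def axSimLob : SimForm := .imp (.imp (.box (.var 0)) (.var 0)) (.var 0)

/-- The modalized Heyting calculus. -/
def mHC : Set SimRule := simGen ({r | ∃ φ, IPC φ ∧ r = ax φ} ∪ {ax axK, ax axR, ax axD})

/-- The Kuznetsov–Muravitsky rule system. -/
def KM : Set SimRule := simGen (mHC ∪ {ax axSimLob})

/-! ### The systems `K4` and `K4.Grz` -/

/-- `K4`: the least rule system containing `/φ` for all `φ` valid in all transitive frames. (Since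
every non-theorem of `K4` fails in a finite transitive frame, it is immaterial in which universe
the frames live.) -/
def K4 : Set ClmRule :=
  clmGen {r | ∃ φ : ClmForm, r = ax φ ∧
    ∀ X : ClmFrame.{0}, (∀ x y z, X.rel x y → X.rel y z → X.rel x z) → X.Valid (ax φ)}

/-- `□(□(p → □p) → p) → □p`. -/
def axGrz : ClmForm :=
  .imp (.box (.imp (.box (.imp (.var 0) (.box (.var 0)))) (.var 0))) (.box (.var 0))

def K4Grz : Set ClmRule := clmGen (K4 ∪ {ax axGrz})

/-! ### The translation and the mappings `τ` and `σ` -/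

/-- The translation `T` of superintuitionistic modal formulae into classical modal formulae. -/
def trans : SimForm → ClmForm
  | .var n => .boxPlus (.var n)
  | .bot => .bot
  | .top => .top
  | .and φ ψ => .and (trans φ) (trans ψ)
  | .or φ ψ => .or (trans φ) (trans ψ)
  | .imp φ ψ => .boxPlus (.or (.neg (trans φ)) (trans ψ))
  | .box φ => .box (trans φ)

/-- `τL := K4 ⊕ {T(Γ/Δ) : Γ/Δ ∈ L}`. -/
def tau (L : Set SimRule) : Set ClmRule := clmGen (K4 ∪ Rule.map trans '' L)

/-- `σL := K4.Grz ⊕ τL`. -/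
def sigma (L : Set SimRule) : Set ClmRule := clmGen (K4Grz ∪ tau L)

end ModalCompanion

namespace ModalCompanion

/-! ### Rules holding under an interpretation -/

/-! On frames the two sides agree. Frames for `KM` have transitive ⊏, frames for `K4` are
transitive, and T φ under W has the value of φ under the upset interiors of the W(p)
(`SimFrame.interp_trans`). So L and τL have the same frames, carriers included, and both
equivalences reduce to moving an underivable rule across T.

A ∼-rule outside L stays outside τL after translation (`mem_of_map_trans_mem_tau`). In a canonical
model for L, the Boolean combinations of values of ∼-formulae are closed under the classical
connectives and □, and the upset interior of each is again the value of a ∼-formula. By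
structurality of L, τL holds under all these valuations.

Conversely, a classical rule r outside τL must yield a ∼-rule outside L (`exists_map_nf_notMem`).
The difficulty is that a canonical model for τL has an arbitrary valuation, while ∼-formulae see
only upsets. The Löb axiom helps: a formula failing strictly above x has a last failure above x
(`ClmFrame.isLob_of_tau`). The last failures of ψ form □ψ ∖ □⁺ψ, and there p is recovered from the
upset □⁺ψ ∨ (□ψ ∧ p). The points that are last failures of no relevant ψ can be merged according to
which of the finitely many relevant □ψ they satisfy, and r is still refuted
(`ClmFrame.mem_interp_collapse`). The new valuation consists of Boolean combinations of definable
upsets (`ClmFrame.isBool_collapse`), so normal forms turn r into the required ∼-rule.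

The last-failure property also gives the Grzegorczyk axiom, whence τL = σL. -/

/-- The rule `r` holds when `I` is the set of designated formulae. -/
def Rule.Holds {F : Type} (I : F → Prop) (r : Rule F) : Prop :=
  (∀ γ ∈ r.1, I γ) → ∃ δ ∈ r.2, I δ

theorem Rule.holds_map {F G : Type} [DecidableEq G] (f : F → G) (I : G → Prop) (r : Rule F) :
    (r.map f).Holds I ↔ r.Holds (fun φ => I (f φ)) := by
  simp [Rule.Holds, Rule.map]

theorem holds_ax {F : Type} (I : F → Prop) (φ : F) : (ax φ).Holds I ↔ I φ := by
  simp [Rule.Holds, ax]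

theorem Rule.holds_congr {F : Type} {I J : F → Prop} (h : ∀ φ, I φ ↔ J φ) (r : Rule F) :
    r.Holds I ↔ r.Holds J := by
  simp [Rule.Holds, h]

theorem ax_map {F G : Type} [DecidableEq G] (f : F → G) (φ : F) :
    (ax φ).map f = ax (f φ) := by
  simp [ax, Rule.map]

/-! ### Lindenbaum lemmas -/

/-- A rule outside a rule system is separated from it by a set of formulae. -/
theorem IsRuleSystem.exists_separating {F : Type} [DecidableEq F] {imp : F → F → F} {box : F → F}
    {subst : (ℕ → F) → F → F} {S : Set (Rule F)} (hS : IsRuleSystem imp box subst S)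
    {r : Rule F} (hr : r ∉ S) :
    ∃ I : Set F, (∀ s ∈ S, Rule.Holds (· ∈ I) s) ∧ ¬ r.Holds (· ∈ I) := by
  -- The Boolean tag records the side of a rule: `true` for premises, `false` for conclusions. `Con`
  -- collects the sets from which no rule of S can be formed.
  let Con : Set (Set (F × Bool)) := {P | ∀ Γ Δ : Finset F, (∀ φ ∈ Γ, (φ, true) ∈ P) →
    (∀ φ ∈ Δ, (φ, false) ∈ P) → ((Γ, Δ) : Rule F) ∉ S}
  have weaken : ∀ {Γ Δ Γ' Δ' : Finset F}, Γ ⊆ Γ' → Δ ⊆ Δ' → ((Γ, Δ) : Rule F) ∈ S →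
      ((Γ', Δ') : Rule F) ∈ S := by
    intro Γ Δ Γ' Δ' h₁ h₂ h
    have := hS.monotonicity Γ Δ Γ' Δ' h
    rwa [Finset.union_eq_right.2 h₁, Finset.union_eq_right.2 h₂] at this
  let P₀ : Set (F × Bool) := {q | (q.2 = true ∧ q.1 ∈ r.1) ∨ (q.2 = false ∧ q.1 ∈ r.2)}
  have hP₀ : P₀ ∈ Con := by
    intro Γ Δ hΓ hΔ h
    refine hr (weaken (Γ' := r.1) (Δ' := r.2) ?_ ?_ h)
    · intro φ hφ
      simpa [P₀] using hΓ φ hφ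
    · intro φ hφ
      simpa [P₀] using hΔ φ hφ
  obtain ⟨P, hP₀P, hP⟩ := zorn_subset_nonempty Con (by
    intro c hc hchain hne
    refine ⟨⋃₀ c, ?_, fun s hs => Set.subset_sUnion_of_mem hs⟩
    intro Γ Δ hΓ hΔ
    have hsub : ((Γ.image (fun φ => (φ, true)) ∪ Δ.image (fun φ => (φ, false)) :
        Finset (F × Bool)) : Set (F × Bool)) ⊆ ⋃₀ c := by
      intro q hq
      simp only [Finset.coe_union, Finset.coe_image, Set.mem_union, Set.mem_image,
        Finset.mem_coe] at hq
      rcases hq with ⟨φ, hφ, rfl⟩ | ⟨φ, hφ, rfl⟩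
      · exact hΓ φ hφ
      · exact hΔ φ hφ
    obtain ⟨P, hPc, hP⟩ := DirectedOn.exists_mem_subset_of_finset_subset_biUnion hne
      (f := id) (c := c) (by simpa [Function.onFun] using hchain.directedOn) (by
        rwa [Set.sUnion_eq_biUnion] at hsub)
    refine hc hPc Γ Δ (fun φ hφ => hP ?_) (fun φ hφ => hP ?_) <;> simp [hφ]) P₀ hP₀
  have total : ∀ φ, (φ, true) ∈ P ∨ (φ, false) ∈ P := by
    intro φ
    by_contra! hφ
    have key : ∀ b, (φ, b) ∉ P → insert (φ, b) P ∉ Con := fun b hb h =>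
      hb (hP.2 h (Set.subset_insert _ _) (Set.mem_insert _ _))
    have h₁ := key true hφ.1
    have h₂ := key false hφ.2
    simp only [Con, Set.mem_ofPred_eq, not_forall, not_not] at h₁ h₂
    obtain ⟨Γ₁, Δ₁, hΓ₁, hΔ₁, h₁⟩ := h₁
    obtain ⟨Γ₂, Δ₂, hΓ₂, hΔ₂, h₂⟩ := h₂
    refine hP.1 (Γ₁.erase φ ∪ Γ₂) (Δ₁ ∪ Δ₂.erase φ) ?_ ?_ (hS.cut _ _ φ
      (weaken ?_ ?_ h₂) (weaken ?_ ?_ h₁))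
    · intro ψ hψ
      rcases Finset.mem_union.1 hψ with h | h
      · have := hΓ₁ ψ (Finset.mem_of_mem_erase h)
        simpa [Finset.ne_of_mem_erase h] using this
      · simpa using hΓ₂ ψ h
    · intro ψ hψ
      rcases Finset.mem_union.1 hψ with h | h
      · simpa using hΔ₁ ψ h
      · have := hΔ₂ ψ (Finset.mem_of_mem_erase h)
        simpa [Finset.ne_of_mem_erase h] using this
    all_goals
      intro ψ hψ
      simp only [Finset.mem_insert, Finset.mem_union, Finset.mem_erase]
      tauto
  have excl : ∀ φ, (φ, true) ∈ P → (φ, false) ∈ P → False := fun φ h₁ h₂ =>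
    hP.1 {φ} {φ} (by simpa using h₁) (by simpa using h₂) (hS.reflexivity φ)
  refine ⟨{φ | (φ, true) ∈ P}, ?_, ?_⟩
  · intro s hs hΓ
    by_contra! hΔ
    exact hP.1 s.1 s.2 hΓ (fun φ hφ => (total φ).resolve_left (hΔ φ hφ)) hs
  · intro h
    obtain ⟨δ, hδ, hδ'⟩ := h (fun γ hγ => hP₀P (Or.inl ⟨rfl, hγ⟩))
    exact excl δ hδ' (hP₀P (Or.inr ⟨rfl, hδ⟩))

/-- Sets of formulae closed under modus ponens and containing the axioms for implication. -/
structure IsImpTheory {F : Type} (imp : F → F → F) (K : Set F) : Prop where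
  k : ∀ α β, imp α (imp β α) ∈ K
  s : ∀ α β γ, imp (imp α (imp β γ)) (imp (imp α β) (imp α γ)) ∈ K
  mp : ∀ {α β}, imp α β ∈ K → α ∈ K → β ∈ K

theorem IsImpTheory.imp_self {F : Type} {imp : F → F → F} {K : Set F} (hK : IsImpTheory imp K)
    (α : F) : imp α α ∈ K :=
  hK.mp (hK.mp (hK.s α (imp α α) α) (hK.k _ _)) (hK.k _ _)

theorem IsImpTheory.of_mem {F : Type} {imp : F → F → F} {K : Set F} (hK : IsImpTheory imp K)
    (α : F) {β : F} (h : β ∈ K) : imp α β ∈ K :=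
  hK.mp (hK.k _ _) h

/-- The theory generated by adding the formula `α` to `K`. -/
theorem IsImpTheory.extend {F : Type} {imp : F → F → F} {K : Set F} (hK : IsImpTheory imp K)
    (α : F) : IsImpTheory imp {β | imp α β ∈ K} where
  k _ _ := hK.of_mem _ (hK.k _ _)
  s _ _ _ := hK.of_mem _ (hK.s _ _ _)
  mp h₁ h₂ := hK.mp (hK.mp (hK.s _ _ _) h₁) h₂

/-- A theory omitting `φ` extends to one that is maximal among those omitting `φ`. -/
theorem IsImpTheory.exists_maximal {F : Type} {imp : F → F → F} {K : Set F}
    (hK : IsImpTheory imp K) {φ : F} (hφ : φ ∉ K) :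
    ∃ x, K ⊆ x ∧ IsImpTheory imp x ∧ φ ∉ x ∧ ∀ α, α ∉ x → imp α φ ∈ x := by
  obtain ⟨x, hKx, hx⟩ := zorn_subset_nonempty {x | IsImpTheory imp x ∧ φ ∉ x} (by
    intro c hc hchain hne
    refine ⟨⋃₀ c, ⟨⟨?_, ?_, ?_⟩, ?_⟩, fun s hs => Set.subset_sUnion_of_mem hs⟩
    · intro α β
      obtain ⟨y, hy⟩ := hne
      exact ⟨y, hy, (hc hy).1.k _ _⟩
    · intro α β γ
      obtain ⟨y, hy⟩ := hne
      exact ⟨y, hy, (hc hy).1.s _ _ _⟩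
    · rintro α β ⟨y, hy, hαβ⟩ ⟨z, hz, hα⟩
      rcases hchain.total hy hz with h | h
      · exact ⟨z, hz, (hc hz).1.mp (h hαβ) hα⟩
      · exact ⟨y, hy, (hc hy).1.mp hαβ (h hα)⟩
    · rintro ⟨y, hy, h⟩
      exact (hc hy).2 h) K ⟨hK, hφ⟩
  refine ⟨x, hKx, hx.1.1, hx.1.2, fun α hα => ?_⟩
  by_contra hαφ
  -- Otherwise the theory generated by x and α would still omit φ, so by maximality it would be x,
  -- although it contains α.
  exact hα (hx.2 (y := {β | imp α β ∈ x}) ⟨hx.1.1.extend α, hαφ⟩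
    (fun β hβ => hx.1.1.of_mem α hβ) (hx.1.1.imp_self α))

/-! ### Substitution and interpretation -/

theorem SimFrame.interp_subst (X : SimFrame.{u}) (V : ℕ → Set X.carrier) (s : ℕ → SimForm)
    (φ : SimForm) : X.interp V (φ.subst s) = X.interp (fun n => X.interp V (s n)) φ := by
  induction φ <;> simp_all [SimForm.subst, SimFrame.interp]

theorem ClmFrame.interp_subst (X : ClmFrame.{u}) (V : ℕ → Set X.carrier) (s : ℕ → ClmForm)
    (φ : ClmForm) : X.interp V (φ.subst s) = X.interp (fun n => X.interp V (s n)) φ := by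
  induction φ <;> simp_all [ClmForm.subst, ClmFrame.interp]

theorem ClmFrame.mem_interp_or (X : ClmFrame.{u}) (V : ℕ → Set X.carrier) (φ ψ : ClmForm)
    (x : X.carrier) : x ∈ X.interp V (φ.or ψ) ↔ x ∈ X.interp V φ ∨ x ∈ X.interp V ψ := by
  simp only [ClmForm.or, ClmFrame.interp, Set.mem_compl_iff, Set.mem_inter_iff]
  tauto

theorem ClmFrame.mem_interp_imp (X : ClmFrame.{u}) (V : ℕ → Set X.carrier) (φ ψ : ClmForm)
    (x : X.carrier) : x ∈ X.interp V (φ.imp ψ) ↔ (x ∈ X.interp V φ → x ∈ X.interp V ψ) := by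
  rw [ClmForm.imp, X.mem_interp_or, ClmFrame.interp, Set.mem_compl_iff]
  tauto

theorem ClmFrame.mem_interp_box (X : ClmFrame.{u}) (V : ℕ → Set X.carrier) (φ : ClmForm)
    (x : X.carrier) : x ∈ X.interp V φ.box ↔ ∀ y, X.rel x y → y ∈ X.interp V φ := Iff.rfl

theorem ClmFrame.mem_interp_boxPlus (X : ClmFrame.{u}) (V : ℕ → Set X.carrier) (φ : ClmForm)
    (x : X.carrier) : x ∈ X.interp V φ.boxPlus ↔
      (∀ y, X.rel x y → y ∈ X.interp V φ) ∧ x ∈ X.interp V φ := Iff.rfl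

/-- The formulae true throughout a model. -/
def ClmFrame.True (X : ClmFrame.{u}) (V : ℕ → Set X.carrier) (φ : ClmForm) : Prop :=
  X.interp V φ = Set.univ

/-- The formulae true throughout a model. -/
def SimFrame.True (X : SimFrame.{u}) (V : ℕ → Set X.carrier) (φ : SimForm) : Prop :=
  X.interp V φ = Set.univ

theorem ClmFrame.true_iff (X : ClmFrame.{u}) (V : ℕ → Set X.carrier) (φ : ClmForm) :
    X.True V φ ↔ ∀ x, x ∈ X.interp V φ := Set.eq_univ_iff_forall

theorem SimFrame.true_iff (X : SimFrame.{u}) (V : ℕ → Set X.carrier) (φ : SimForm) :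
    X.True V φ ↔ ∀ x, x ∈ X.interp V φ := Set.eq_univ_iff_forall

def ClmFrame.Transitive (X : ClmFrame.{u}) : Prop :=
  ∀ x y z, X.rel x y → X.rel y z → X.rel x z

/-- A family of valuations closed under substitution determines a rule system. -/
theorem ClmFrame.isClmRuleSystem_holds (X : ClmFrame.{u}) (C : Set (ℕ → Set X.carrier))
    (hC : ∀ W ∈ C, ∀ s : ℕ → ClmForm, (fun n => X.interp W (s n)) ∈ C) :
    IsClmRuleSystem {r | ∀ W ∈ C, r.Holds (X.True W)} where
  structurality s r hr W hW := by
    rw [Rule.holds_map]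
    refine (Rule.holds_congr (fun φ => ?_) r).1 (hr _ (hC W hW s))
    simp [ClmFrame.True, X.interp_subst]
  reflexivity φ W _ := by simp [Rule.Holds]
  monotonicity Γ Δ Γ' Δ' hr W hW h := by
    obtain ⟨δ, hδ, h'⟩ := hr W hW (fun γ hγ => h γ (Finset.mem_union_left _ hγ))
    exact ⟨δ, Finset.mem_union_left _ hδ, h'⟩
  cut Γ Δ φ h₁ h₂ W hW h := by
    obtain ⟨δ, hδ, h'⟩ := h₁ W hW h
    rcases Finset.mem_insert.1 hδ with rfl | hδ
    · refine h₂ W hW fun γ hγ => ?_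
      rcases Finset.mem_insert.1 hγ with rfl | hγ
      exacts [h', h γ hγ]
    · exact ⟨δ, hδ, h'⟩
  modusPonens φ ψ W _ h := by
    refine ⟨ψ, by simp, (X.true_iff _ _).2 fun x => ?_⟩
    have h₁ := (X.true_iff _ _).1 (h φ (by simp)) x
    have h₂ := (X.true_iff _ _).1 (h (φ.imp ψ) (by simp)) x
    exact (X.mem_interp_imp _ _ _ _).1 h₂ h₁
  necessitation φ W _ h := by
    refine ⟨φ.box, by simp, (X.true_iff _ _).2 fun x y _ => ?_⟩
    exact (X.true_iff _ _).1 (h φ (by simp)) y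

/-! ### `K4` and transitive frames -/

/-- The formulae true at a point of a model. -/
def ClmFrame.theoryOf (X : ClmFrame.{u}) (V : ℕ → Set X.carrier) (x : X.carrier) :
    Set ClmForm := {φ | x ∈ X.interp V φ}

/-- The frame of the theories of points of a model. -/
def ClmFrame.theoryFrame (X : ClmFrame.{u}) (V : ℕ → Set X.carrier) : ClmFrame.{0} where
  carrier := Set.range (X.theoryOf V)
  -- The second conjunct makes the relation transitive by construction.
  rel s t := ∀ φ, ClmForm.box φ ∈ s.1 → φ ∈ t.1 ∧ ClmForm.box φ ∈ t.1

/-- Transitivity of X makes every related pair of points have related theories, even for the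
strengthened relation. As theories are sets of formulae, this moves models of any universe to the
lowest one, where `K4` is defined. -/
theorem ClmFrame.mem_interp_theoryFrame (X : ClmFrame.{u}) (hX : X.Transitive)
    (V : ℕ → Set X.carrier) (φ : ClmForm) (s : (X.theoryFrame V).carrier) :
    s ∈ (X.theoryFrame V).interp (fun n => {t | ClmForm.var n ∈ t.1}) φ ↔ φ ∈ s.1 := by
  induction φ generalizing s with
  | var n => exact Iff.rfl
  | bot => obtain ⟨_, x, rfl⟩ := s; exact Iff.rfl
  | top => obtain ⟨_, x, rfl⟩ := s; exact Iff.rfl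
  | and φ ψ ih₁ ih₂ =>
    obtain ⟨_, x, rfl⟩ := s
    exact and_congr (ih₁ _) (ih₂ _)
  | neg φ ih =>
    obtain ⟨_, x, rfl⟩ := s
    exact not_congr (ih _)
  | box φ ih =>
    constructor
    · intro h
      obtain ⟨_, x, rfl⟩ := s
      intro y hxy
      exact (ih ⟨_, y, rfl⟩).1 (h ⟨_, y, rfl⟩ fun ψ hψ =>
        ⟨hψ y hxy, fun z hyz => hψ z (hX x y z hxy hyz)⟩)
    · intro h t hst
      exact (ih t).2 (hst φ h).1

/-- Formulae valid in all small transitive frames are valid in all transitive frames. -/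
theorem ClmFrame.Transitive.true_of_small {X : ClmFrame.{u}} (hX : X.Transitive) {φ : ClmForm}
    (hφ : ∀ Y : ClmFrame.{0}, Y.Transitive → Y.Valid (ax φ)) (V : ℕ → Set X.carrier) :
    X.True V φ := by
  rw [X.true_iff]
  intro x
  have htr : (X.theoryFrame V).Transitive := fun s t v hst htv ψ hψ => htv ψ (hst ψ hψ).2
  have h : (X.theoryFrame V).True (fun n => {t | ClmForm.var n ∈ t.1}) φ :=
    (holds_ax _ _).1 (hφ _ htr _)
  exact (X.mem_interp_theoryFrame hX V φ ⟨_, x, rfl⟩).1 ((ClmFrame.true_iff _ _ _).1 h _)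

theorem clmGen_subset {Ξ S : Set ClmRule} (hS : IsClmRuleSystem S) (h : Ξ ⊆ S) :
    clmGen Ξ ⊆ S := Set.sInter_subset_of_mem ⟨hS, h⟩

theorem ClmFrame.Transitive.K4_subset {X : ClmFrame.{u}} (hX : X.Transitive)
    {C : Set (ℕ → Set X.carrier)}
    (hC : ∀ W ∈ C, ∀ s : ℕ → ClmForm, (fun n => X.interp W (s n)) ∈ C) :
    K4 ⊆ {r | ∀ W ∈ C, r.Holds (X.True W)} := by
  refine clmGen_subset (X.isClmRuleSystem_holds C hC) ?_
  rintro _ ⟨φ, rfl, hφ⟩ W _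
  exact (holds_ax _ _).2 (hX.true_of_small hφ W)

theorem ax_mem_K4 {φ : ClmForm} (h : ∀ X : ClmFrame.{0}, X.Transitive →
    ∀ V x, x ∈ X.interp V φ) : ax φ ∈ K4 := by
  refine subset_clmGen _ ⟨φ, rfl, fun X hX V => ?_⟩
  exact (holds_ax (X.True V) φ).2 ((X.true_iff _ _).2 (h X hX V))

/-! ### Canonical models of classical modal rule systems -/

/-- The points of the canonical frame: the complete consistent theories over `I`. -/
structure IsClmPoint (I x : Set ClmForm) : Prop where
  subset : I ⊆ x
  mp : ∀ {α β}, ClmForm.imp α β ∈ x → α ∈ x → β ∈ x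
  neg_iff : ∀ α, ClmForm.neg α ∈ x ↔ α ∉ x

def clmCanonical (I : Set ClmForm) : ClmFrame.{0} where
  carrier := {x // IsClmPoint I x}
  rel x y := ∀ φ, ClmForm.box φ ∈ x.1 → φ ∈ y.1

/-- Sets of formulae containing the theorems of `K4` and closed under modus ponens. -/
structure IsK4Theory (K : Set ClmForm) : Prop where
  ax_mem : ∀ φ, ax φ ∈ K4 → φ ∈ K
  mp : ∀ {α β}, ClmForm.imp α β ∈ K → α ∈ K → β ∈ K

theorem IsK4Theory.mem_of_valid {K : Set ClmForm} (hK : IsK4Theory K) {φ : ClmForm}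
    (h : ∀ X : ClmFrame.{0}, X.Transitive → ∀ V x, x ∈ X.interp V φ) : φ ∈ K :=
  hK.ax_mem _ (ax_mem_K4 h)

theorem IsK4Theory.isImpTheory {K : Set ClmForm} (hK : IsK4Theory K) :
    IsImpTheory ClmForm.imp K where
  k α β := hK.mem_of_valid fun X _ V x => by simp only [X.mem_interp_imp]; tauto
  s α β γ := hK.mem_of_valid fun X _ V x => by simp only [X.mem_interp_imp]; tauto
  mp := hK.mp

/-- A theory maximal among those omitting φ is complete: if it omitted both α and ¬α, it would
contain α → φ and ¬α → φ, hence φ. -/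
theorem IsK4Theory.exists_point {I K : Set ClmForm} (hI : IsK4Theory I) (hIK : I ⊆ K)
    (hK : ∀ {α β}, ClmForm.imp α β ∈ K → α ∈ K → β ∈ K) {φ : ClmForm} (hφ : φ ∉ K) :
    ∃ x, IsClmPoint I x ∧ K ⊆ x ∧ φ ∉ x := by
  have hK4 : IsK4Theory K := ⟨fun ψ h => hIK (hI.ax_mem ψ h), hK⟩
  obtain ⟨x, hKx, hx, hφx, hmax⟩ := hK4.isImpTheory.exists_maximal hφ
  have hx4 : IsK4Theory x := ⟨fun ψ h => hKx (hK4.ax_mem ψ h), hx.mp⟩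
  refine ⟨x, ⟨hIK.trans hKx, hx.mp, fun α => ⟨fun h₁ h₂ => hφx ?_, fun h => ?_⟩⟩, hKx, hφx⟩
  · refine hx.mp (hx.mp (hx4.mem_of_valid (φ := α.neg.imp (α.imp φ)) fun X _ V y => ?_) h₁) h₂
    simp only [X.mem_interp_imp, ClmFrame.interp, Set.mem_compl_iff]; tauto
  · by_contra hn
    refine hφx (hx.mp (hx.mp (hx4.mem_of_valid
      (φ := (α.imp φ).imp ((α.neg.imp φ).imp φ)) fun X _ V y => ?_) (hmax _ h)) (hmax _ hn))
    simp only [X.mem_interp_imp, ClmFrame.interp, Set.mem_compl_iff]; tauto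

theorem IsClmPoint.mem_of_valid {I x : Set ClmForm} (hx : IsClmPoint I x) (hI : IsK4Theory I)
    {φ : ClmForm} (h : ∀ X : ClmFrame.{0}, X.Transitive → ∀ V x, x ∈ X.interp V φ) : φ ∈ x :=
  hx.subset (hI.mem_of_valid h)

theorem transitive_clmCanonical {I : Set ClmForm} (hI : IsK4Theory I) :
    (clmCanonical I).Transitive := by
  intro x y z hxy hyz φ hφ
  refine hyz φ (hxy _ (x.2.mp (x.2.mem_of_valid hI (φ := φ.box.imp φ.box.box) ?_) hφ))
  intro X hX V w
  simp only [X.mem_interp_imp, X.mem_interp_box]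
  exact fun h y hwy z hyz => h z (hX w y z hwy hyz)

/-- The canonical valuation. -/
def clmCanonicalVal (I : Set ClmForm) (n : ℕ) : Set (clmCanonical I).carrier :=
  {x | ClmForm.var n ∈ x.1}

/-- For □, a successor omitting φ is found over {ψ | □ψ ∈ x}. This set contains I because I is
closed under necessitation, so the successor is again a point over I. -/
theorem mem_interp_clmCanonical {I : Set ClmForm} (hI : IsK4Theory I)
    (hnec : ∀ φ, φ ∈ I → ClmForm.box φ ∈ I) (φ : ClmForm) (x : (clmCanonical I).carrier) :
    x ∈ (clmCanonical I).interp (clmCanonicalVal I) φ ↔ φ ∈ x.1 := by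
  have hmp : ∀ (x : (clmCanonical I).carrier) {α β : ClmForm},
      (∀ X : ClmFrame.{0}, X.Transitive → ∀ V x, x ∈ X.interp V (α.imp β)) →
      α ∈ x.1 → β ∈ x.1 := fun x _ _ h => x.2.mp (x.2.mem_of_valid hI h)
  induction φ generalizing x with
  | var n => exact Iff.rfl
  | bot =>
    refine iff_of_false id fun h => ?_
    have : ClmForm.neg .bot ∈ x.1 := x.2.mem_of_valid hI fun X _ V y => id
    exact (x.2.neg_iff _).1 this h
  | top => exact iff_of_true trivial (x.2.mem_of_valid hI fun X _ V y => trivial)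
  | and φ ψ ih₁ ih₂ =>
    refine (and_congr (ih₁ x) (ih₂ x)).trans ⟨fun h => x.2.mp (hmp x ?_ h.1) h.2, fun h =>
      ⟨hmp x ?_ h, hmp x ?_ h⟩⟩ <;> intro X _ V y <;>
      simp only [X.mem_interp_imp, ClmFrame.interp, Set.mem_inter_iff] <;> tauto
  | neg φ ih => exact (not_congr (ih x)).trans (x.2.neg_iff φ).symm
  | box φ ih =>
    refine ⟨fun h => ?_, fun h y hxy => (ih y).2 (hxy φ h)⟩
    by_contra hφ
    obtain ⟨y, hy, hKy, hφy⟩ := hI.exists_point (K := {ψ | ClmForm.box ψ ∈ x.1})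
      (fun ψ hψ => x.2.subset (hnec ψ hψ)) (by
        intro α β h₁ h₂
        refine x.2.mp (hmp x (α := (α.imp β).box) ?_ h₁) h₂
        intro X _ V w
        simp only [X.mem_interp_imp, X.mem_interp_box]
        exact fun h₁ h₂ y hwy => h₁ y hwy (h₂ y hwy)) hφ
    exact hφy ((ih ⟨y, hy⟩).1 (h ⟨y, hy⟩ fun ψ hψ => hKy hψ))

/-- Completeness with respect to transitive models. -/
theorem IsClmRuleSystem.exists_model {M : Set ClmRule} (hM : IsClmRuleSystem M) (hK4 : K4 ⊆ M)
    {r : ClmRule} (hr : r ∉ M) :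
    ∃ (Y : ClmFrame.{0}) (W : ℕ → Set Y.carrier), Y.Transitive ∧
      (∀ s ∈ M, Rule.Holds (Y.True W) s) ∧ ¬ r.Holds (Y.True W) := by
  obtain ⟨I, hIM, hIr⟩ := IsRuleSystem.exists_separating hM hr
  have hI : IsK4Theory I := by
    refine ⟨fun φ h => (holds_ax _ _).1 (hIM _ (hK4 h)), fun {α β} h₁ h₂ => ?_⟩
    obtain ⟨δ, hδ, h⟩ := hIM _ (hM.modusPonens α β) (by simp [h₁, h₂])
    rwa [Finset.mem_singleton.1 hδ] at h
  have hnec : ∀ φ, φ ∈ I → ClmForm.box φ ∈ I := by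
    intro φ hφ
    obtain ⟨δ, hδ, h⟩ := hIM _ (hM.necessitation φ) (by simp [hφ])
    rwa [Finset.mem_singleton.1 hδ] at h
  have key : ∀ φ, φ ∈ I ↔ (clmCanonical I).True (clmCanonicalVal I) φ := by
    intro φ
    rw [ClmFrame.true_iff]
    simp only [mem_interp_clmCanonical hI hnec]
    refine ⟨fun h x => x.2.subset h, fun h => ?_⟩
    by_contra hφ
    obtain ⟨x, hx, -, hφx⟩ := hI.exists_point subset_rfl hI.mp hφ
    exact hφx (h ⟨x, hx⟩)
  exact ⟨clmCanonical I, clmCanonicalVal I, transitive_clmCanonical hI,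
    fun s hs => (Rule.holds_congr key s).1 (hIM s hs),
    fun h => hIr ((Rule.holds_congr key r).2 h)⟩

/-! ### Canonical models of superintuitionistic modal rule systems -/

/-- Sets of formulae containing the theorems of `mHC` and closed under modus ponens. -/
structure IsMHCTheory (K : Set SimForm) : Prop where
  ipc : ∀ φ, IPC φ → φ ∈ K
  distrib : ∀ α β, SimForm.imp (.box (.imp α β)) (.imp (.box α) (.box β)) ∈ K
  inflate : ∀ α, SimForm.imp α (.box α) ∈ K
  split : ∀ α β, SimForm.imp (.box α) (.or β (.imp β α)) ∈ K
  mp : ∀ {α β}, SimForm.imp α β ∈ K → α ∈ K → β ∈ K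

theorem IsMHCTheory.isImpTheory {K : Set SimForm} (hK : IsMHCTheory K) :
    IsImpTheory SimForm.imp K :=
  ⟨fun _ _ => hK.ipc _ (.k _ _), fun _ _ _ => hK.ipc _ (.s _ _ _), hK.mp⟩

theorem IsMHCTheory.mono {K K' : Set SimForm} (hK : IsMHCTheory K) (h : K ⊆ K')
    (hmp : ∀ {α β}, SimForm.imp α β ∈ K' → α ∈ K' → β ∈ K') : IsMHCTheory K' :=
  ⟨fun φ hφ => h (hK.ipc φ hφ), fun α β => h (hK.distrib α β), fun α => h (hK.inflate α),
    fun α β => h (hK.split α β), hmp⟩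

/-- The points of the canonical frame: the prime theories over `I`. -/
structure IsSimPoint (I x : Set SimForm) : Prop extends IsMHCTheory x where
  subset : I ⊆ x
  bot_notMem : SimForm.bot ∉ x
  prime : ∀ {α β}, SimForm.or α β ∈ x → α ∈ x ∨ β ∈ x

theorem IsMHCTheory.exists_point {I K : Set SimForm} (hK : IsMHCTheory K) (hIK : I ⊆ K)
    {φ : SimForm} (hφ : φ ∉ K) : ∃ x, IsSimPoint I x ∧ K ⊆ x ∧ φ ∉ x := by
  obtain ⟨x, hKx, hx, hφx, hmax⟩ := hK.isImpTheory.exists_maximal hφ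
  have hx' := hK.mono hKx hx.mp
  refine ⟨x, ⟨hx', hIK.trans hKx, fun h => hφx (hx.mp (hx'.ipc _ (.botElim φ)) h), ?_⟩, hKx, hφx⟩
  intro α β h
  by_contra! hn
  exact hφx (hx.mp (hx.mp (hx.mp (hx'.ipc _ (.orElim α β φ)) (hmax α hn.1)) (hmax β hn.2)) h)

/-- The axiom ⊠p → (q ∨ (q → p)) turns every proper inclusion of prime theories into an instance of
`rel`, and p → ⊠p turns `rel` into inclusion. Hence inclusion is the reflexive closure of `rel`. -/
def simCanonical (I : Set SimForm) : SimFrame.{0} where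
  carrier := {x // IsSimPoint I x}
  le x y := x.1 ⊆ y.1
  rel x y := ∀ φ, SimForm.box φ ∈ x.1 → φ ∈ y.1
  le_refl x := subset_rfl
  le_trans x y z h₁ h₂ := h₁.trans h₂
  le_iff x y := by
    constructor
    · intro hxy
      by_cases hyx : y.1 ⊆ x.1
      · exact Or.inl (Subtype.ext (hxy.antisymm hyx))
      · obtain ⟨ψ, hψy, hψx⟩ := Set.not_subset.1 hyx
        refine Or.inr fun φ hφ => ?_
        have h := (x.2.prime (x.2.mp (x.2.split φ ψ) hφ)).resolve_left hψx
        exact y.2.mp (hxy h) hψy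
    · rintro (rfl | h)
      · exact subset_rfl
      · exact fun φ hφ => h φ (x.2.mp (x.2.inflate φ) hφ)

/-- Transitivity of ⊏ is not part of being a ∼-frame; here it comes from p → ⊠p. It is what lets the
canonical frame serve as a frame for `K4`. -/
theorem transitive_simCanonical (I : Set SimForm) (x y z : (simCanonical I).carrier)
    (hxy : (simCanonical I).rel x y) (hyz : (simCanonical I).rel y z) :
    (simCanonical I).rel x z :=
  fun φ hφ => hyz φ (y.2.mp (y.2.inflate φ) (hxy φ hφ))

/-- The canonical valuation. -/
def simCanonicalVal (I : Set SimForm) (n : ℕ) : Set (simCanonical I).carrier :=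
  {x | SimForm.var n ∈ x.1}

theorem mem_interp_simCanonical (I : Set SimForm) (φ : SimForm) (x : (simCanonical I).carrier) :
    x ∈ (simCanonical I).interp (simCanonicalVal I) φ ↔ φ ∈ x.1 := by
  induction φ generalizing x with
  | var n => exact Iff.rfl
  | bot => exact iff_of_false id x.2.bot_notMem
  | top => exact iff_of_true trivial (x.2.ipc _ .topIntro)
  | and φ ψ ih₁ ih₂ =>
    exact (and_congr (ih₁ x) (ih₂ x)).trans
      ⟨fun h => x.2.mp (x.2.mp (x.2.ipc _ (.andIntro _ _)) h.1) h.2, fun h =>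
        ⟨x.2.mp (x.2.ipc _ (.andLeft _ _)) h, x.2.mp (x.2.ipc _ (.andRight _ _)) h⟩⟩
  | or φ ψ ih₁ ih₂ =>
    exact (or_congr (ih₁ x) (ih₂ x)).trans
      ⟨fun h => h.elim (x.2.mp (x.2.ipc _ (.orLeft _ _))) (x.2.mp (x.2.ipc _ (.orRight _ _))),
        x.2.prime⟩
  | imp φ ψ ih₁ ih₂ =>
    constructor
    · intro h
      by_contra hn
      have hx := x.2.isImpTheory
      obtain ⟨y, hy, hKy, hψy⟩ := (x.2.toIsMHCTheory.mono
        (fun β hβ => hx.of_mem φ hβ) (hx.extend φ).mp).exists_point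
        (fun β hβ => hx.of_mem φ (x.2.subset hβ)) hn
      exact hψy ((ih₂ ⟨y, hy⟩).1 (h ⟨y, hy⟩ (fun β hβ => hKy (hx.of_mem φ hβ))
        ((ih₁ _).2 (hKy (hx.imp_self φ)))))
    · intro h y hxy hy
      exact (ih₂ y).2 (y.2.mp (hxy h) ((ih₁ y).1 hy))
  | box φ ih =>
    refine ⟨fun h => ?_, fun h y hxy => (ih y).2 (hxy φ h)⟩
    by_contra hφ
    have hsub : x.1 ⊆ {ψ | SimForm.box ψ ∈ x.1} := fun ψ hψ => x.2.mp (x.2.inflate ψ) hψ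
    obtain ⟨y, hy, hKy, hφy⟩ := (x.2.toIsMHCTheory.mono hsub
      (fun h₁ h₂ => x.2.mp (x.2.mp (x.2.distrib _ _) h₁) h₂)).exists_point
      (x.2.subset.trans hsub) hφ
    exact hφy ((ih ⟨y, hy⟩).1 (h ⟨y, hy⟩ fun ψ hψ => hKy hψ))

def SimFrame.RelTransitive (X : SimFrame.{u}) : Prop :=
  ∀ x y z, X.rel x y → X.rel y z → X.rel x z

theorem IsSimRuleSystem.ax_subst {L : Set SimRule} (hL : IsSimRuleSystem L) {φ : SimForm}
    (h : ax φ ∈ L) (s : ℕ → SimForm) : ax (φ.subst s) ∈ L := by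
  have := hL.structurality s _ h
  rwa [ax_map] at this

/-- Completeness with respect to models on transitive frames. -/
theorem IsSimRuleSystem.exists_model {L : Set SimRule} (hL : IsSimRuleSystem L) (hmHC : mHC ⊆ L)
    {r : SimRule} (hr : r ∉ L) :
    ∃ (Y : SimFrame.{0}) (V : ℕ → Set Y.carrier), Y.RelTransitive ∧ (∀ n, Y.IsUp (V n)) ∧
      (∀ s ∈ L, Rule.Holds (Y.True V) s) ∧ ¬ r.Holds (Y.True V) := by
  obtain ⟨I, hIL, hIr⟩ := IsRuleSystem.exists_separating hL hr
  have hax : ∀ φ, ax φ ∈ L → φ ∈ I := fun φ h => (holds_ax _ _).1 (hIL _ h)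
  have hgen := fun r h => hmHC (subset_simGen _ (a := r) h)
  have hI : IsMHCTheory I := by
    refine ⟨fun φ h => hax _ (hgen _ (Or.inl ⟨φ, h, rfl⟩)), fun α β => ?_, fun α => ?_,
      fun α β => ?_, fun {α β} h₁ h₂ => ?_⟩
    · exact hax _ (hL.ax_subst (hgen (ax axK) (by simp)) fun n => if n = 0 then α else β)
    · exact hax _ (hL.ax_subst (hgen (ax axR) (by simp)) fun _ => α)
    · exact hax _ (hL.ax_subst (hgen (ax axD) (by simp)) fun n => if n = 0 then α else β)
    · obtain ⟨δ, hδ, h⟩ := hIL _ (hL.modusPonens α β) (by simp [h₁, h₂])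
      rwa [Finset.mem_singleton.1 hδ] at h
  have key : ∀ φ, φ ∈ I ↔ (simCanonical I).True (simCanonicalVal I) φ := by
    intro φ
    rw [SimFrame.true_iff]
    simp only [mem_interp_simCanonical]
    refine ⟨fun h x => x.2.subset h, fun h => ?_⟩
    by_contra hφ
    obtain ⟨x, hx, -, hφx⟩ := hI.exists_point subset_rfl hφ
    exact hφx (h ⟨x, hx⟩)
  exact ⟨simCanonical I, simCanonicalVal I, transitive_simCanonical I,
    fun n x y hxy hx => hxy hx, fun s hs => (Rule.holds_congr key s).1 (hIL s hs),
    fun h => hIr ((Rule.holds_congr key r).2 h)⟩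

/-! ### The translation -/

/-- The classical modal frame underlying a `∼`-frame. -/
abbrev SimFrame.toClm (X : SimFrame.{u}) : ClmFrame.{u} := ⟨X.carrier, X.rel⟩

/-- A transitive classical modal frame as a `∼`-frame. -/
abbrev ClmFrame.toSim (X : ClmFrame.{u}) (hX : X.Transitive) : SimFrame.{u} where
  carrier := X.carrier
  le x y := x = y ∨ X.rel x y
  rel := X.rel
  le_refl _ := Or.inl rfl
  le_trans x y z := by
    rintro (rfl | h₁) (rfl | h₂)
    exacts [Or.inl rfl, Or.inr h₂, Or.inr h₁, Or.inr (hX _ _ _ h₁ h₂)]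
  le_iff _ _ := Iff.rfl

/-- The largest upset contained in `U`. -/
def SimFrame.core (X : SimFrame.{u}) (U : Set X.carrier) : Set X.carrier :=
  {x | ∀ y, X.le x y → y ∈ U}

theorem SimFrame.isUp_core (X : SimFrame.{u}) (U : Set X.carrier) : X.IsUp (X.core U) :=
  fun x y hxy hx z hyz => hx z (X.le_trans x y z hxy hyz)

theorem SimFrame.IsUp.core_eq {X : SimFrame.{u}} {U : Set X.carrier} (hU : X.IsUp U) :
    X.core U = U :=
  Set.Subset.antisymm (fun x hx => hx x (X.le_refl x)) fun x hx y hxy => hU x y hxy hx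

theorem SimFrame.interp_boxPlus (X : SimFrame.{u}) (W : ℕ → Set X.carrier) (φ : ClmForm) :
    X.toClm.interp W φ.boxPlus = X.core (X.toClm.interp W φ) := by
  ext x
  refine (X.toClm.mem_interp_boxPlus _ _ _).trans ⟨fun h y hxy => ?_, fun h => ⟨fun y hxy => ?_, ?_⟩⟩
  · rcases (X.le_iff x y).1 hxy with rfl | hxy
    exacts [h.2, h.1 y hxy]
  · exact h y ((X.le_iff x y).2 (Or.inr hxy))
  · exact h x (X.le_refl x)

/-- □⁺ along ⊏ is the upset interior along ≤, so T replaces variables by their interiors and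
otherwise reproduces the ∼-clauses. -/
theorem SimFrame.interp_trans (X : SimFrame.{u}) (W : ℕ → Set X.carrier) (φ : SimForm) :
    X.toClm.interp W (ModalCompanion.trans φ) = X.interp (fun n => X.core (W n)) φ := by
  induction φ with
  | var n => exact X.interp_boxPlus W (.var n)
  | bot => rfl
  | top => rfl
  | and φ ψ ih₁ ih₂ => exact congrArg₂ _ ih₁ ih₂
  | or φ ψ ih₁ ih₂ =>
    ext x
    rw [ModalCompanion.trans, X.toClm.mem_interp_or, ih₁, ih₂]
    rfl
  | imp φ ψ ih₁ ih₂ =>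
    rw [ModalCompanion.trans, X.interp_boxPlus]
    ext x
    refine forall₂_congr fun y _ => ?_
    rw [X.toClm.mem_interp_or, ClmFrame.interp, Set.mem_compl_iff, ih₁, ih₂]
    tauto
  | box φ ih =>
    ext x
    exact forall₂_congr fun y _ => by rw [ih]

theorem SimFrame.holds_map_trans (X : SimFrame.{u}) (W : ℕ → Set X.carrier) (r : SimRule) :
    (r.map ModalCompanion.trans).Holds (X.toClm.True W) ↔
      r.Holds (X.True fun n => X.core (W n)) := by
  rw [Rule.holds_map]
  exact Rule.holds_congr (fun φ => by rw [ClmFrame.True, X.interp_trans]; rfl) r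

theorem isClmRuleSystem_tau (L : Set SimRule) : IsClmRuleSystem (tau L) :=
  isClmRuleSystem_clmGen _

theorem K4_subset_tau (L : Set SimRule) : K4 ⊆ tau L :=
  Set.subset_union_left.trans (subset_clmGen _)

theorem map_trans_mem_tau {L : Set SimRule} {r : SimRule} (hr : r ∈ L) :
    r.map ModalCompanion.trans ∈ tau L :=
  subset_clmGen _ (Or.inr ⟨r, hr, rfl⟩)

/-- Soundness of `τL` for a family of valuations closed under substitution. -/
theorem SimFrame.tau_subset (X : SimFrame.{u}) (hX : X.RelTransitive) {L : Set SimRule}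
    {C : Set (ℕ → Set X.carrier)}
    (hC : ∀ W ∈ C, ∀ s : ℕ → ClmForm, (fun n => X.toClm.interp W (s n)) ∈ C)
    (hL : ∀ W ∈ C, ∀ r ∈ L, Rule.Holds (X.True fun n => X.core (W n)) r) :
    tau L ⊆ {r | ∀ W ∈ C, r.Holds (X.toClm.True W)} := by
  refine clmGen_subset (X.toClm.isClmRuleSystem_holds C hC) (Set.union_subset ?_ ?_)
  · exact ClmFrame.Transitive.K4_subset (X := X.toClm) hX hC
  · rintro _ ⟨r, hr, rfl⟩ W hW
    exact (X.holds_map_trans W r).2 (hL W hW r hr)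

/-! ### Boolean combinations of upsets -/

/-- Conjunctive normal forms over `∼`-formulae: lists of implications, read classically. -/
abbrev NF : Type := List (SimForm × SimForm)

/-- The pointwise value of a normal form. -/
def SimFrame.evalNF (X : SimFrame.{u}) (V : ℕ → Set X.carrier) (l : NF) : Set X.carrier :=
  {x | ∀ c ∈ l, x ∈ X.interp V c.1 → x ∈ X.interp V c.2}

/-- ¬((a → b) ∧ l) is (¬l ∨ a) ∧ (¬l ∨ ¬b). In each clause of ¬l the disjunct a joins the right
side, and ¬b becomes the conjunct b on the left. -/
def NF.neg : NF → NF
  | [] => [(.top, .bot)]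
  | (a, b) :: l => (NF.neg l).map (fun c => (c.1, .or c.2 a)) ++
      (NF.neg l).map (fun c => (.and c.1 b, c.2))

/-- The `∼`-formula expressing that a normal form is true at all points above. -/
def NF.toForm : NF → SimForm
  | [] => .top
  | (a, b) :: l => .and (.imp a b) (NF.toForm l)

/-- The normal form of a classical modal formula whose variables are given normal forms. -/
def nf (b : ℕ → NF) : ClmForm → NF
  | .var n => b n
  | .bot => [(.top, .bot)]
  | .top => []
  | .and φ ψ => nf b φ ++ nf b ψ
  | .neg φ => NF.neg (nf b φ)
  | .box φ => [(.top, .box (NF.toForm (nf b φ)))]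

theorem SimFrame.evalNF_append (X : SimFrame.{u}) (V : ℕ → Set X.carrier) (l m : NF) :
    X.evalNF V (l ++ m) = X.evalNF V l ∩ X.evalNF V m := by
  ext x
  exact List.forall_mem_append

theorem SimFrame.mem_evalNF_single (X : SimFrame.{u}) (V : ℕ → Set X.carrier) (a : SimForm)
    (x : X.carrier) : x ∈ X.evalNF V [(.top, a)] ↔ x ∈ X.interp V a := by
  simp [SimFrame.evalNF, SimFrame.interp]

theorem SimFrame.evalNF_neg (X : SimFrame.{u}) (V : ℕ → Set X.carrier) (l : NF) :
    X.evalNF V (NF.neg l) = (X.evalNF V l)ᶜ := by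
  induction l with
  | nil => ext x; simp [SimFrame.evalNF, NF.neg, SimFrame.interp]
  | cons c l ih =>
    obtain ⟨a, b⟩ := c
    ext x
    have ih := Set.ext_iff.1 ih x
    have h₁ : x ∈ X.evalNF V ((NF.neg l).map fun c => (c.1, .or c.2 a)) ↔
        x ∈ X.evalNF V (NF.neg l) ∨ x ∈ X.interp V a := by
      simp only [SimFrame.evalNF, Set.mem_ofPred_eq, List.forall_mem_map, SimFrame.interp,
        Set.mem_union]
      by_cases h : x ∈ X.interp V a <;> simp [h]
    have h₂ : x ∈ X.evalNF V ((NF.neg l).map fun c => (.and c.1 b, c.2)) ↔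
        x ∈ X.evalNF V (NF.neg l) ∨ x ∉ X.interp V b := by
      simp only [SimFrame.evalNF, Set.mem_ofPred_eq, List.forall_mem_map, SimFrame.interp,
        Set.mem_inter_iff]
      by_cases h : x ∈ X.interp V b <;> simp [h]
    have h₃ : x ∈ X.evalNF V ((a, b) :: l) ↔
        (x ∈ X.interp V a → x ∈ X.interp V b) ∧ x ∈ X.evalNF V l := List.forall_mem_cons
    rw [NF.neg, X.evalNF_append, Set.mem_inter_iff, h₁, h₂, Set.mem_compl_iff, h₃, ih,
      Set.mem_compl_iff]
    tauto

theorem SimFrame.interp_toForm (X : SimFrame.{u}) (V : ℕ → Set X.carrier) (l : NF) :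
    X.interp V (NF.toForm l) = X.core (X.evalNF V l) := by
  induction l with
  | nil => ext x; simp [SimFrame.evalNF, NF.toForm, SimFrame.interp, SimFrame.core]
  | cons c l ih =>
    ext x
    rw [NF.toForm, SimFrame.interp, Set.mem_inter_iff, ih]
    refine forall_and.symm.trans (forall_congr' fun y => ?_)
    rw [show y ∈ X.evalNF V (c :: l) ↔ (y ∈ X.interp V c.1 → y ∈ X.interp V c.2) ∧
      y ∈ X.evalNF V l from List.forall_mem_cons]
    tauto

/-- The only non-Boolean case is □. On a transitive frame the successors of a point form an upset,
so □U is □ of the interior of U, and that interior is the value of a ∼-formula. -/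
theorem SimFrame.interp_nf (X : SimFrame.{u}) (hX : X.RelTransitive) (V : ℕ → Set X.carrier)
    (b : ℕ → NF) (φ : ClmForm) :
    X.toClm.interp (fun n => X.evalNF V (b n)) φ = X.evalNF V (nf b φ) := by
  induction φ with
  | var n => rfl
  | bot => ext x; exact (X.mem_evalNF_single V .bot x).symm
  | top => ext x; simp [ClmFrame.interp, nf, SimFrame.evalNF]
  | and φ ψ ih₁ ih₂ =>
    exact (congrArg₂ (· ∩ ·) ih₁ ih₂).trans (X.evalNF_append V _ _).symm
  | neg φ ih => exact (congrArg _ ih).trans (X.evalNF_neg V _).symm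
  | box φ ih =>
    ext x
    rw [nf, X.mem_evalNF_single, X.toClm.mem_interp_box, ih, SimFrame.interp, X.interp_toForm]
    refine ⟨fun h y hxy z hyz => ?_, fun h y hxy => h y hxy y (X.le_refl y)⟩
    rcases (X.le_iff y z).1 hyz with rfl | hyz
    exacts [h y hxy, h z (hX x y z hxy hyz)]

theorem SimFrame.core_eq_univ_iff (X : SimFrame.{u}) (U : Set X.carrier) :
    X.core U = Set.univ ↔ U = Set.univ := by
  simp only [Set.eq_univ_iff_forall]
  exact ⟨fun h x => h x x (X.le_refl x), fun h x y _ => h y⟩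

theorem SimFrame.holds_map_nf (X : SimFrame.{u}) (hX : X.RelTransitive)
    (V : ℕ → Set X.carrier) (b : ℕ → NF) (r : ClmRule) :
    (r.map fun φ => NF.toForm (nf b φ)).Holds (X.True V) ↔
      r.Holds (X.toClm.True fun n => X.evalNF V (b n)) := by
  rw [Rule.holds_map]
  refine Rule.holds_congr (fun φ => ?_) r
  rw [SimFrame.True, ClmFrame.True, X.interp_nf hX, X.interp_toForm, X.core_eq_univ_iff]

/-- The translation is faithful. -/
theorem mem_of_map_trans_mem_tau {L : Set SimRule} (hL : IsSimRuleSystem L) (hmHC : mHC ⊆ L)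
    {r : SimRule} (hr : r.map ModalCompanion.trans ∈ tau L) : r ∈ L := by
  by_contra hrL
  obtain ⟨X, V, hX, hV, hVL, hVr⟩ := hL.exists_model hmHC hrL
  refine hVr ?_
  -- The family of valuations by normal forms contains V and is closed under classical substitution.
  -- Its interiors are values of ∼-formulae, so L holds there by structurality.
  have h := X.tau_subset hX (L := L) (C := Set.range fun b n => X.evalNF V (b n)) ?_ ?_ hr V
    ⟨fun n => [(.top, .var n)], ?_⟩
  · have hcore : (fun n => X.core (V n)) = V := funext fun n => (hV n).core_eq
    have h' := (X.holds_map_trans V r).1 h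
    rwa [hcore] at h'
  · rintro _ ⟨b, rfl⟩ s
    exact ⟨fun n => nf b (s n), funext fun n => (X.interp_nf hX V b (s n)).symm⟩
  · rintro _ ⟨b, rfl⟩ s hs
    have h := hVL _ (hL.structurality (fun n => NF.toForm (b n)) s hs)
    rw [Rule.holds_map] at h
    refine (Rule.holds_congr (fun φ => ?_) s).1 h
    simp only [SimFrame.True, X.interp_subst, X.interp_toForm]
  · funext n
    ext x
    exact X.mem_evalNF_single V (.var n) x

/-! ### Frames for `L` and frames for `τL` -/

theorem SimFrame.relTransitive_of_isFrameFor_KM {X : SimFrame.{u}} (hX : X.IsFrameFor KM) :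
    X.RelTransitive := by
  intro x y z hxy hyz
  have hle := fun {a b} (h : X.rel a b) => (X.le_iff a b).2 (Or.inr h)
  rcases (X.le_iff x z).1 (X.le_trans x y z (hle hxy) (hle hyz)) with rfl | h
  · by_contra hxx
    -- Let p say "not below x". If x lies on a ⊏-cycle, every point both above and below x refutes
    -- ⊠p, so ⊠p → p holds throughout ↑x and the Löb axiom forces p at x.
    let V : ℕ → Set X.carrier := fun _ => {w | ¬ X.le w x}
    have hV : ∀ n, X.IsUp (V n) := fun n a b hab ha hb => ha (X.le_trans a b x hab hb)
    have h : X.True V axSimLob := (holds_ax _ _).1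
      (hX (ax axSimLob) (subset_simGen _ (Or.inr rfl)) V hV)
    refine (X.true_iff _ _).1 h x x (X.le_refl x) (fun w hxw hw hwx => ?_) (X.le_refl x)
    rcases (X.le_iff w x).1 hwx with rfl | hwx
    · exact hw y hxy (hle hyz)
    · exact hw x hwx (X.le_refl x)
  · exact h

theorem ClmFrame.transitive_of_isFrameFor_K4 {X : ClmFrame.{u}} (hX : X.IsFrameFor K4) :
    X.Transitive := by
  intro x y z hxy hyz
  have h : ax ((ClmForm.var 0).box.imp (ClmForm.var 0).box.box) ∈ K4 := by
    refine ax_mem_K4 fun X hX V w => ?_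
    simp only [X.mem_interp_imp, X.mem_interp_box]
    exact fun h y hwy z hyz => h z (hX w y z hwy hyz)
  have h' := (X.true_iff _ _).1 ((holds_ax _ _).1 (hX _ h fun _ => {w | X.rel x w})) x
  simp only [X.mem_interp_imp, X.mem_interp_box] at h'
  exact h' (fun _ h => h) y hxy z hyz

theorem SimFrame.isFrameFor_tau {X : SimFrame.{u}} (hX : X.RelTransitive) {L : Set SimRule}
    (hL : X.IsFrameFor L) : X.toClm.IsFrameFor (tau L) := by
  intro r hr W
  exact X.tau_subset hX (C := Set.univ) (fun _ _ _ => trivial)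
    (fun W _ s hs => hL s hs _ fun n => X.isUp_core _) hr W trivial

theorem ClmFrame.holds_map_trans {X : ClmFrame.{u}} (hX : X.Transitive)
    {V : ℕ → Set X.carrier} (hV : ∀ n, (X.toSim hX).IsUp (V n)) (r : SimRule) :
    (r.map ModalCompanion.trans).Holds (X.True V) ↔ r.Holds ((X.toSim hX).True V) := by
  have hcore : (fun n => (X.toSim hX).core (V n)) = V := funext fun n => (hV n).core_eq
  have := (X.toSim hX).holds_map_trans V r
  rwa [hcore] at this

theorem ClmFrame.isFrameFor_toSim {X : ClmFrame.{u}} (hX : X.Transitive) {L : Set SimRule}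
    (hL : X.IsFrameFor (tau L)) : (X.toSim hX).IsFrameFor L :=
  fun _ hr V hV => (ClmFrame.holds_map_trans hX hV _).1 (hL _ (map_trans_mem_tau hr) V)

theorem ClmFrame.not_valid_toSim {X : ClmFrame.{u}} (hX : X.Transitive) {r : SimRule}
    (hr : ¬ X.Valid (r.map ModalCompanion.trans)) : ¬ (X.toSim hX).Valid r := by
  intro h
  exact hr fun W => ((X.toSim hX).holds_map_trans W r).2 (h _ fun n => (X.toSim hX).isUp_core _)

/-! ### Löb models -/

/-- Every formula that fails strictly above a point has a last failure above that point. -/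
def ClmFrame.IsLob (X : ClmFrame.{u}) (W : ℕ → Set X.carrier) : Prop :=
  ∀ φ x, x ∉ X.interp W (.box φ) →
    ∃ y, X.rel x y ∧ y ∈ X.interp W (.box φ) ∧ y ∉ X.interp W φ

/-- The translated Löb axiom, with □⁺φ for p, is evaluated at a failure y of φ above x. If no point
above x were a last failure, ⊠p → p would hold at every point of ↑y, hence φ at y. -/
theorem ClmFrame.isLob_of_tau {L : Set SimRule} (hKM : KM ⊆ L) {X : ClmFrame.{u}}
    (hX : X.Transitive) {W : ℕ → Set X.carrier} (hW : ∀ s ∈ tau L, Rule.Holds (X.True W) s) :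
    X.IsLob W := by
  intro φ x hx
  rw [X.mem_interp_box] at hx
  push Not at hx
  obtain ⟨y, hxy, hy⟩ := hx
  have h := hW _ ((isClmRuleSystem_tau L).structurality (fun _ => φ.boxPlus) _
    (map_trans_mem_tau (hKM (subset_simGen _ (Or.inr rfl)))))
  rw [ax_map, ax_map, holds_ax, ClmFrame.True, X.interp_subst] at h
  have h := (Set.eq_univ_iff_forall.1 (((X.toSim hX).interp_trans _ _).symm.trans h)) y y
    (Or.inl rfl)
  have hcore : ∀ z, (z ∈ (X.toSim hX).core (X.interp W φ.boxPlus)) ↔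
      z ∈ X.interp W φ.box ∧ z ∈ X.interp W φ := by
    intro z
    have h₁ := (X.toSim hX).interp_boxPlus W φ
    rw [show X.interp W φ.boxPlus = _ from h₁, ((X.toSim hX).isUp_core _).core_eq, ← h₁]
    exact X.mem_interp_boxPlus W φ z
  by_contra! hno
  refine hy ((hcore y).1 (h fun z hyz hz => (hcore z).2 ?_)).2
  have hxz : X.rel x z := by
    rcases hyz with rfl | hyz
    exacts [hxy, hX _ _ _ hxy hyz]
  have hbox : z ∈ X.interp W φ.box := fun w hzw => ((hcore w).1 (hz w hzw)).2
  exact ⟨hbox, hno z hxz hbox⟩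

/-- At a last failure y of p, □p holds, so by transitivity □(p → □p) does too; the premise of the
axiom then forces p at y. -/
theorem axGrz_mem_tau {L : Set SimRule} (hKM : KM ⊆ L) : ax axGrz ∈ tau L := by
  by_contra h
  obtain ⟨X, W, hX, hW, hn⟩ := (isClmRuleSystem_tau L).exists_model (K4_subset_tau L) h
  have hLob := ClmFrame.isLob_of_tau hKM hX hW
  rw [holds_ax, X.true_iff] at hn
  refine hn fun x => ?_
  rw [axGrz, X.mem_interp_imp]
  intro hx
  by_contra hp
  obtain ⟨y, hxy, hy, hyp⟩ := hLob _ _ hp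
  have h := hx y hxy
  rw [X.mem_interp_imp] at h
  refine hyp (h fun z hyz => ?_)
  rw [X.mem_interp_imp]
  exact fun _ w hzw => hy w (hX _ _ _ hyz hzw)

theorem tau_eq_sigma {L : Set SimRule} (hKM : KM ⊆ L) : tau L = sigma L := by
  refine Set.Subset.antisymm (Set.subset_union_right.trans (subset_clmGen _)) ?_
  refine clmGen_subset (isClmRuleSystem_tau L) (Set.union_subset ?_ subset_rfl)
  refine clmGen_subset (isClmRuleSystem_tau L) (Set.union_subset (K4_subset_tau L) ?_)
  rintro _ rfl
  exact axGrz_mem_tau hKM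

/-! ### Replacing a valuation by Boolean combinations of upsets -/

/-- The formulae `ψ` such that `□ψ` is a subformula. -/
def ClmForm.boxBodies : ClmForm → Finset ClmForm
  | .var _ => ∅
  | .bot => ∅
  | .top => ∅
  | .and φ ψ => φ.boxBodies ∪ ψ.boxBodies
  | .neg φ => φ.boxBodies
  | .box φ => insert φ φ.boxBodies

section Collapse

variable (X : ClmFrame.{u}) (W : ℕ → Set X.carrier) (B : Finset ClmForm)

open Classical in
/-- The elements `ψ` of `B` with `□ψ` true at a point. -/
noncomputable def ClmFrame.boxType (y : X.carrier) : Finset ClmForm :=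
  B.filter fun ψ => y ∈ X.interp W (.box ψ)

/-- The points at which `□ψ → ψ` is true for all `ψ ∈ B`. -/
def ClmFrame.reflPart : Set X.carrier :=
  {y | ∀ ψ ∈ B, y ∈ X.interp W (.box ψ) → y ∈ X.interp W ψ}

theorem ClmFrame.mem_boxType {ψ : ClmForm} (hψ : ψ ∈ B) (y : X.carrier) :
    ψ ∈ X.boxType W B y ↔ y ∈ X.interp W (.box ψ) := by
  simp [ClmFrame.boxType, hψ]

open Classical in
/-- The points of `reflPart` with the same `boxType` are sent to one of them; other points are
fixed. -/
noncomputable def ClmFrame.collapse (y : X.carrier) : X.carrier :=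
  if y ∈ X.reflPart W B then
    @Classical.epsilon X.carrier ⟨y⟩
      fun z => z ∈ X.reflPart W B ∧ X.boxType W B z = X.boxType W B y
  else y

theorem ClmFrame.collapse_of_notMem {y : X.carrier} (hy : y ∉ X.reflPart W B) :
    X.collapse W B y = y := if_neg hy

theorem ClmFrame.collapse_of_mem {y : X.carrier} (hy : y ∈ X.reflPart W B) :
    X.collapse W B y ∈ X.reflPart W B ∧
      X.boxType W B (X.collapse W B y) = X.boxType W B y := by
  rw [ClmFrame.collapse, if_pos hy]
  exact Classical.epsilon_spec
    (p := fun z => z ∈ X.reflPart W B ∧ X.boxType W B z = X.boxType W B y) ⟨y, hy, rfl⟩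

theorem ClmFrame.boxType_collapse (y : X.carrier) :
    X.boxType W B (X.collapse W B y) = X.boxType W B y := by
  by_cases hy : y ∈ X.reflPart W B
  · exact (X.collapse_of_mem W B hy).2
  · rw [X.collapse_of_notMem W B hy]

theorem ClmFrame.collapse_congr {y z : X.carrier} (hy : y ∈ X.reflPart W B)
    (hz : z ∈ X.reflPart W B) (h : X.boxType W B y = X.boxType W B z) :
    X.collapse W B y = X.collapse W B z := by
  rw [ClmFrame.collapse, if_pos hy, ClmFrame.collapse, if_pos hz, h]

variable {X W B}

/-- For □ψ: collapsing preserves box types. If □ψ fails at y, a last failure of ψ above y lies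
outside `reflPart` and so is not moved. If □ψ holds at the image of y, it holds at y and at its
successors; a merged successor then has a representative with □ψ true, and therefore with ψ true. -/
theorem ClmFrame.mem_interp_collapse (hX : X.Transitive) (hW : X.IsLob W) (φ : ClmForm)
    (hφ : φ.boxBodies ⊆ B) (y : X.carrier) :
    y ∈ X.interp (fun n => X.collapse W B ⁻¹' W n) φ ↔ X.collapse W B y ∈ X.interp W φ := by
  induction φ generalizing y with
  | var n => exact Iff.rfl
  | bot => exact Iff.rfl
  | top => exact Iff.rfl
  | and φ ψ ih₁ ih₂ =>
    exact and_congr (ih₁ (Finset.union_subset_left hφ) y) (ih₂ (Finset.union_subset_right hφ) y)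
  | neg φ ih => exact not_congr (ih hφ y)
  | box ψ ih =>
    have hψ : ψ ∈ B := hφ (Finset.mem_insert_self _ _)
    have ih := ih ((Finset.subset_insert _ _).trans hφ)
    rw [← X.mem_boxType W B hψ, X.boxType_collapse, X.mem_boxType W B hψ, X.mem_interp_box]
    simp only [ih]
    constructor
    · intro h
      by_contra hy
      obtain ⟨z, hyz, hz, hzψ⟩ := hW ψ y hy
      have hzD : z ∉ X.reflPart W B := fun hzD => hzψ (hzD ψ hψ hz)
      have := h z hyz
      rw [X.collapse_of_notMem W B hzD] at this
      exact hzψ this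
    · intro hy z hyz
      by_cases hzD : z ∈ X.reflPart W B
      · refine (X.collapse_of_mem W B hzD).1 ψ hψ ?_
        rw [← X.mem_boxType W B hψ, X.boxType_collapse, X.mem_boxType W B hψ]
        exact fun w hzw => hy w (hX _ _ _ hyz hzw)
      · rw [X.collapse_of_notMem W B hzD]
        exact hy z hyz

/-- The modified valuation refutes the same rules. -/
theorem ClmFrame.holds_of_holds_collapse (hX : X.Transitive) (hW : X.IsLob W) {r : ClmRule}
    (h₁ : ∀ φ ∈ r.1 ∪ r.2, φ.boxBodies ⊆ B) (h₂ : r.2 ⊆ B)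
    (h : r.Holds (X.True fun n => X.collapse W B ⁻¹' W n)) : r.Holds (X.True W) := by
  intro hΓ
  obtain ⟨δ, hδ, hδW⟩ := h fun γ hγ => (X.true_iff _ _).2 fun x =>
    (X.mem_interp_collapse hX hW γ (h₁ γ (Finset.mem_union_left _ hγ)) x).2
      ((X.true_iff _ _).1 (hΓ γ hγ) _)
  have hδB := h₁ δ (Finset.mem_union_right _ hδ)
  -- Since δ ∈ B, a last failure of δ would be fixed by the collapse and so visible under the new
  -- valuation. Without last failures, δ has no failures at all.
  have key : ∀ z, z ∈ X.interp W δ.box → z ∈ X.interp W δ := by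
    intro z hz
    by_contra hzδ
    have hzD : z ∉ X.reflPart W B := fun hzD => hzδ (hzD δ (h₂ hδ) hz)
    have := (X.mem_interp_collapse hX hW δ hδB z).1 ((X.true_iff _ _).1 hδW z)
    rw [X.collapse_of_notMem W B hzD] at this
    exact hzδ this
  refine ⟨δ, hδ, (X.true_iff _ _).2 fun x => key x ?_⟩
  by_contra hx
  obtain ⟨z, -, hz, hzδ⟩ := hW δ x hx
  exact hzδ (key z hz)

end Collapse

/-! ### Definability of the collapsed valuation -/

/-- The sets that are Boolean combinations of values of formulae. -/
def SimFrame.IsBool (X : SimFrame.{u}) (V : ℕ → Set X.carrier) (S : Set X.carrier) : Prop :=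
  ∃ l, X.evalNF V l = S

section IsBool

variable {X : SimFrame.{u}} {V : ℕ → Set X.carrier} {S S' : Set X.carrier}

theorem SimFrame.IsBool.compl (h : X.IsBool V S) : X.IsBool V Sᶜ := by
  obtain ⟨l, rfl⟩ := h
  exact ⟨l.neg, X.evalNF_neg V l⟩

theorem SimFrame.IsBool.inter (h : X.IsBool V S) (h' : X.IsBool V S') : X.IsBool V (S ∩ S') := by
  obtain ⟨l, rfl⟩ := h
  obtain ⟨l', rfl⟩ := h'
  exact ⟨l ++ l', X.evalNF_append V l l'⟩

theorem SimFrame.IsBool.union (h : X.IsBool V S) (h' : X.IsBool V S') :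
    X.IsBool V (S ∪ S') := by
  have := (h.compl.inter h'.compl).compl
  rwa [Set.compl_inter, compl_compl, compl_compl] at this

theorem SimFrame.isBool_univ : X.IsBool V Set.univ := ⟨[], by simp [SimFrame.evalNF]⟩

theorem SimFrame.isBool_val (n : ℕ) : X.IsBool V (V n) :=
  ⟨[(.top, .var n)], Set.ext fun x => X.mem_evalNF_single V (.var n) x⟩

theorem SimFrame.isBool_const (p : Prop) : X.IsBool V {_x | p} := by
  by_cases hp : p
  · simpa [hp] using SimFrame.isBool_univ (X := X) (V := V)
  · simpa [hp] using (SimFrame.isBool_univ (X := X) (V := V)).compl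

theorem SimFrame.isBool_biUnion {ι : Type} (B : Finset ι) (f : ι → Set X.carrier)
    (h : ∀ i ∈ B, X.IsBool V (f i)) : X.IsBool V (⋃ i ∈ B, f i) := by
  classical
  induction B using Finset.induction_on with
  | empty => simpa using (SimFrame.isBool_univ (X := X) (V := V)).compl
  | insert i B _ ih =>
    rw [Finset.set_biUnion_insert]
    exact (h i (Finset.mem_insert_self _ _)).union
      (ih fun j hj => h j (Finset.mem_insert_of_mem hj))

end IsBool

section Definable

variable {X : ClmFrame.{u}} {hX : X.Transitive} {W V : ℕ → Set X.carrier} {B : Finset ClmForm}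

theorem ClmFrame.isUp_interp_box (hX : X.Transitive) (W : ℕ → Set X.carrier) (φ : ClmForm) :
    (X.toSim hX).IsUp (X.interp W φ.box) := by
  rintro x y (rfl | hxy) hx
  · exact hx
  · exact fun z hyz => hx z (hX _ _ _ hxy hyz)

theorem ClmFrame.isUp_interp_boxPlus (hX : X.Transitive) (W : ℕ → Set X.carrier) (φ : ClmForm) :
    (X.toSim hX).IsUp (X.interp W φ.boxPlus) := by
  rw [(X.toSim hX).interp_boxPlus]
  exact SimFrame.isUp_core _ _

/-- A box type is a finite list of yes/no answers, each decided by an upset □ψ; the induction splits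
on one answer at a time. -/
theorem ClmFrame.isBool_boxType
    (hV : ∀ φ, (X.toSim hX).IsUp (X.interp W φ) → ∃ n, V n = X.interp W φ)
    (F : Finset ClmForm → Prop) : (X.toSim hX).IsBool V {y | F (X.boxType W B y)} := by
  classical
  induction B using Finset.induction_on generalizing F with
  | empty => simpa [ClmFrame.boxType] using SimFrame.isBool_const _
  | insert ψ B _ ih =>
    have hψ : (X.toSim hX).IsBool V (X.interp W ψ.box) := by
      obtain ⟨n, hn⟩ := hV _ (X.isUp_interp_box hX W ψ)
      exact hn ▸ SimFrame.isBool_val n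
    convert (hψ.inter (ih fun t => F (insert ψ t))).union (hψ.compl.inter (ih F)) using 1
    ext y
    by_cases hy : y ∈ X.interp W ψ.box <;>
      simp [ClmFrame.boxType, Finset.filter_insert, hy]

/-- Off `reflPart` the collapse is the identity, and variable n is cut out among the last failures
of each ψ ∈ B separately. On `reflPart` the new value depends only on the box type. -/
theorem ClmFrame.isBool_collapse
    (hV : ∀ φ, (X.toSim hX).IsUp (X.interp W φ) → ∃ n, V n = X.interp W φ) (n : ℕ) :
    (X.toSim hX).IsBool V (X.collapse W B ⁻¹' W n) := by
  have hup : ∀ φ, (X.toSim hX).IsUp (X.interp W φ) →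
      (X.toSim hX).IsBool V (X.interp W φ) := by
    intro φ h
    obtain ⟨n, hn⟩ := hV φ h
    exact hn ▸ SimFrame.isBool_val n
  have hbox := fun φ => hup _ (X.isUp_interp_box hX W φ)
  have hplus := fun φ => hup _ (X.isUp_interp_boxPlus hX W φ)
  have hirr : (X.toSim hX).IsBool V (X.reflPart W B)ᶜ := by
    convert SimFrame.isBool_biUnion B _ fun ψ _ => (hbox ψ).inter (hplus ψ).compl using 1
    ext y
    simp [ClmFrame.reflPart, ClmFrame.mem_interp_boxPlus, ClmFrame.mem_interp_box]
    aesop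
  -- Everything strictly above a point of □ψ satisfies □⁺ψ, so this set is an upset whatever the
  -- value of variable n. Removing □⁺ψ leaves the last failures of ψ at which variable n is true.
  have hQ : ∀ ψ : ClmForm, (X.toSim hX).IsBool V
      (X.interp W (ψ.boxPlus.or (ψ.box.and (.var n)))) := by
    intro ψ
    refine hup _ ?_
    rintro x y (rfl | hxy) hx
    · exact hx
    · rw [X.mem_interp_or] at hx ⊢
      have hx : x ∈ X.interp W ψ.box := hx.elim And.left And.left
      exact Or.inl ⟨fun z hyz => hx z (hX _ _ _ hxy hyz), hx y hxy⟩
  have hirrn : (X.toSim hX).IsBool V ((X.reflPart W B)ᶜ ∩ W n) := by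
    convert SimFrame.isBool_biUnion B _ fun ψ _ => (hQ ψ).inter (hplus ψ).compl using 1
    ext y
    simp only [Set.mem_inter_iff, Set.mem_compl_iff, ClmFrame.reflPart, Set.mem_ofPred_eq,
      not_forall, Set.mem_iUnion, X.mem_interp_or, X.mem_interp_boxPlus, ClmFrame.interp]
    constructor
    · rintro ⟨⟨ψ, hψ, h₁, h₂⟩, hn⟩
      exact ⟨ψ, hψ, Or.inr ⟨h₁, hn⟩, fun h => h₂ h.2⟩
    · rintro ⟨ψ, hψ, h₁ | h₁, h₂⟩
      · exact absurd h₁ h₂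
      · exact ⟨⟨ψ, hψ, h₁.1, fun h => h₂ ⟨h₁.1, h⟩⟩, h₁.2⟩
  have hrefl := hirr.compl.inter (ClmFrame.isBool_boxType (B := B) hV
    fun t => ∃ z ∈ X.reflPart W B, X.boxType W B z = t ∧ X.collapse W B z ∈ W n)
  convert hirrn.union hrefl using 1
  ext y
  by_cases hy : y ∈ X.reflPart W B
  · simp only [Set.mem_preimage, Set.mem_union, Set.mem_inter_iff, compl_compl,
      Set.mem_compl_iff, hy, not_true_eq_false, false_and, true_and, false_or,
      Set.mem_ofPred_eq]
    refine ⟨fun h => ⟨y, hy, rfl, h⟩, ?_⟩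
    rintro ⟨z, hz, hzy, h⟩
    rwa [← X.collapse_congr W B hz hy hzy]
  · simp [hy, X.collapse_of_notMem W B hy]

end Definable

/-! ### From classical rules outside τL to ∼-rules outside L -/

/-- A Gödel numbering of classical modal formulae. -/
def ClmForm.code : ClmForm → ℕ
  | .var n => Nat.pair 0 n
  | .bot => Nat.pair 1 0
  | .top => Nat.pair 2 0
  | .and φ ψ => Nat.pair 3 (Nat.pair φ.code ψ.code)
  | .neg φ => Nat.pair 4 φ.code
  | .box φ => Nat.pair 5 φ.code

theorem ClmForm.code_injective : Function.Injective ClmForm.code := by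
  intro φ
  induction φ with
  | and φ ψ ih₁ ih₂ =>
    rintro (_ | _ | _ | ⟨α, β⟩ | _ | _) h <;> simp [ClmForm.code, Nat.pair_eq_pair] at h
    rw [ih₁ h.1, ih₂ h.2]
  | neg φ ih =>
    rintro (_ | _ | _ | _ | _ | _) h <;> simp [ClmForm.code, Nat.pair_eq_pair] at h
    rw [ih h]
  | box φ ih =>
    rintro (_ | _ | _ | _ | _ | _) h <;> simp [ClmForm.code, Nat.pair_eq_pair] at h
    rw [ih h]
  | _ => rintro (_ | _ | _ | _ | _ | _) h <;> simp_all [ClmForm.code, Nat.pair_eq_pair]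

instance : Countable ClmForm := ClmForm.code_injective.countable

/-- A classical modal rule outside `τL` yields a `∼`-rule outside `L`. -/
theorem exists_map_nf_notMem {L : Set SimRule} (hKM : KM ⊆ L) {r : ClmRule} (hr : r ∉ tau L) :
    ∃ b : ℕ → NF, (r.map fun φ => NF.toForm (nf b φ)) ∉ L := by
  obtain ⟨X, W, hX, hW, hWr⟩ := (isClmRuleSystem_tau L).exists_model (K4_subset_tau L) hr
  have hLob := ClmFrame.isLob_of_tau hKM hX hW
  have : Nonempty {φ // (X.toSim hX).IsUp (X.interp W φ)} := ⟨.bot, fun _ _ _ h => h⟩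
  -- The n-th ∼-variable will stand for the n-th classical formula whose value is an upset;
  -- countability of formulae leaves enough variables for all of them.
  obtain ⟨e, he⟩ := exists_surjective_nat {φ // (X.toSim hX).IsUp (X.interp W φ)}
  let V : ℕ → Set X.carrier := fun n => X.interp W (e n).1
  have hV : ∀ φ, (X.toSim hX).IsUp (X.interp W φ) → ∃ n, V n = X.interp W φ := by
    intro φ hφ
    obtain ⟨n, hn⟩ := he ⟨φ, hφ⟩
    exact ⟨n, by simp only [V, hn]⟩
  -- The conclusions are included besides the bodies of boxes, so that their last failures survive
  -- the collapse.
  let B : Finset ClmForm := (r.1 ∪ r.2).biUnion ClmForm.boxBodies ∪ r.2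
  choose b hb using fun n => X.isBool_collapse (B := B) hV n
  refine ⟨b, fun hs => hWr ?_⟩
  -- If the ∼-rule were in L, its translation with variable n replaced by `(e n).1` would hold in
  -- the model. Read back through normal forms, this is r under the collapsed valuation.
  have h₁ := hW _ ((isClmRuleSystem_tau L).structurality (fun n => (e n).1) _
    (map_trans_mem_tau hs))
  rw [Rule.holds_map] at h₁
  have h₂ : Rule.Holds (X.True V) _ := (Rule.holds_congr
    (fun φ => by rw [ClmFrame.True, X.interp_subst]; rfl) _).1 h₁
  have h₃ := ((X.toSim hX).holds_map_nf hX V b r).1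
    ((ClmFrame.holds_map_trans hX (fun n => (e n).2) _).1 h₂)
  rw [funext hb] at h₃
  refine ClmFrame.holds_of_holds_collapse (B := B) hX hLob (fun φ hφ => ?_)
    Finset.subset_union_right h₃
  exact (Finset.subset_biUnion_of_mem ClmForm.boxBodies hφ).trans Finset.subset_union_left

theorem SimFrame.not_valid_toClm {X : SimFrame.{u}} (hX : X.RelTransitive) {b : ℕ → NF}
    {r : ClmRule} (h : ¬ X.Valid (r.map fun φ => NF.toForm (nf b φ))) : ¬ X.toClm.Valid r :=
  fun hr => h fun V _ => (X.holds_map_nf hX V b r).2 (hr _)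

theorem SimFrame.IsFrameFor.mono {X : SimFrame.{u}} {S S' : Set SimRule} (h : X.IsFrameFor S')
    (hS : S ⊆ S') : X.IsFrameFor S := fun r hr => h r (hS hr)

theorem ClmFrame.IsFrameFor.mono {X : ClmFrame.{u}} {S S' : Set ClmRule} (h : X.IsFrameFor S')
    (hS : S ⊆ S') : X.IsFrameFor S := fun r hr => h r (hS hr)

/-- Completeness with respect to frames satisfying a condition on the carrier transfers between
`L` and `τL`. -/
theorem complete_iff_complete_tau {L : Set SimRule} (hL : IsSimRuleSystem L) (hKM : KM ⊆ L)
    (P : Type u → Prop) :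
    (∀ r, r ∉ L → ∃ X : SimFrame.{u}, P X.carrier ∧ X.IsFrameFor L ∧ ¬ X.Valid r) ↔
      ∀ r, r ∉ tau L → ∃ X : ClmFrame.{u}, P X.carrier ∧ X.IsFrameFor (tau L) ∧ ¬ X.Valid r := by
  constructor
  · intro h r hr
    obtain ⟨b, hb⟩ := exists_map_nf_notMem hKM hr
    obtain ⟨X, hP, hXL, hXr⟩ := h _ hb
    have hX := SimFrame.relTransitive_of_isFrameFor_KM (hXL.mono hKM)
    exact ⟨X.toClm, hP, SimFrame.isFrameFor_tau hX hXL, SimFrame.not_valid_toClm hX hXr⟩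
  · intro h r hr
    have hmHC : mHC ⊆ L := (Set.subset_union_left.trans (subset_simGen _)).trans hKM
    obtain ⟨X, hP, hXL, hXr⟩ := h _ fun hT => hr (mem_of_map_trans_mem_tau hL hmHC hT)
    have hX := ClmFrame.transitive_of_isFrameFor_K4 (hXL.mono (K4_subset_tau L))
    exact ⟨X.toSim hX, hP, ClmFrame.isFrameFor_toSim hX hXL, ClmFrame.not_valid_toSim hX hXr⟩

end ModalCompanion

theorem mainTheorem7 (L : Set ModalCompanion.SimRule) (hL : ModalCompanion.IsSimRuleSystem L)
    (hKM : ModalCompanion.KM ⊆ L) :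
    ModalCompanion.tau L = ModalCompanion.sigma L ∧
    (ModalCompanion.SimKripkeComplete.{u} L ↔
      ModalCompanion.ClmKripkeComplete.{u} (ModalCompanion.tau L)) ∧
    (ModalCompanion.SimFMP.{u} L ↔ ModalCompanion.ClmFMP.{u} (ModalCompanion.tau L)) := by
  refine ⟨ModalCompanion.tau_eq_sigma hKM, ?_, ?_⟩
  · simpa only [ModalCompanion.SimKripkeComplete, ModalCompanion.ClmKripkeComplete, true_and]
      using ModalCompanion.complete_iff_complete_tau hL hKM fun _ => True
  · exact ModalCompanion.complete_iff_complete_tau hL hKM fun α => Finite α
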